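/- Let $r\ge 0$ be an integer and let $q,p\in\mathbb C$ with $q\ne 0$ and $|p|<1$. For $x\in\mathbb C^\times$ let $$\theta(x)=\theta(x;p)=\prod_{k\ge 0}(1-xp^k)\prod_{k\ge 0}(1-p^{k+1}/x),\qquad \theta(x_1,\dots,x_m)=\prod_{i=1}^m\theta(x_i),$$ and let $(a;q,p)_n=\prod_{k=0}^{n-1}\theta(aq^k)$ for $n\ge 0$ and $(a;q,p)_n=1/\prod_{k=0}^{-n-1}\theta(aq^{n+k})$ for $n<0$. For integers $s,t,\ell,\rho$ define the elliptic weights $$w_{a,b;q,p}(s,t)=\frac{\theta(aq^{s+2t},\,bq^{2s+t-2},\,aq^{t-s-1}/b)}{\theta(aq^{s+2t-2},\,bq^{2s+t},\,aq^{t-s+1}/b)}\,q,\qquad W_{a,b;q,p}(s,t)=\prod_{j=1}^t w_{a,b;q,p}(s,j),$$ $$W^{(\rho)}_{a,b;q,p}(s,t)=W_{aq^{2\rho},bq^{2\rho};q,p}(s,t),\qquad Q_{a,b;q,p}(\ell,\rho,s,t)=\prod_{i=1}^{\ell}W^{(\rho)}_{a,b;q,p}(i+s,t),$$ where $\prod_{j=1}^{n}f_j$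 means $1/\prod_{j=n+1}^{0}f_j$ if $n<0$. For integers $k_1,\dots,k_r$ with $k_1+\cdots+k_r\ge 0$ put $K_i=k_1+\cdots+k_i$ and define the elliptic multinomial coefficient $$\begin{bmatrix}K_r\\k_1,\dots,k_r\end{bmatrix}_{a_1,\dots,a_r;q,p}=\frac{(q;q,p)_{K_r}}{\prod_{i=1}^r(q;q,p)_{k_i}}\prod_{i=1}^r\frac{(a_iq^{1+K_r-k_i};q,p)_{k_i}}{(a_iq^{1+2K_{i-1}};q,p)_{k_i}}\prod_{1\le i<j\le r}\frac{(a_iq^{1-k_i}/a_j;q,p)_{k_j}}{(a_iq/a_j;q,p)_{k_j}},$$ with the convention that $1/(q;q,p)_{k}=0$ for $k<0$. Theorem. Let $0\le M\le N$ be integers and let $n_1,\dots,n_r\in\mathbb N_0$ with $n_1+\cdots+n_r=N$; put $N_i=n_1+\cdots+n_i$. Let $a_1,\dots,a_r\in\mathbb C^\times$ be generic, in the sense that $\theta(a_iq^m)\neq0$ and $\theta(a_iq^m/a_j)\neq 0$ for all $m\in\mathbb Z$ and all $i<j$, and assume $\theta(q^m)\ne0$ for $1\le m\le N$. Then $$\begin{bmatrix}N\\n_1,\dots,n_r\end{bmatrix}_{a_1,\dots,a_r;q,p}=\sum_{\substack{k_1,\dots,k_r\in\mathbb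 N_0\\k_1+\cdots+k_r=M}}\begin{bmatrix}M\\k_1,\dots,k_r\end{bmatrix}_{a_1,\dots,a_r;q,p}\begin{bmatrix}N-M\\n_1-k_1,\dots,n_r-k_r\end{bmatrix}_{a_1q^{2M-k_1},\dots,a_rq^{2M-k_r};q,p}\prod_{1\le i<j\le r}Q_{a_i,a_j;q,p}(n_i-k_i,\;N_{i-1}+K_{j-1}-K_i,\;k_i,\;k_j),$$ where $K_i=k_1+\cdots+k_i$; summands with some $k_i>n_i$ vanish. -/

import Mathlib

namespace EllMult

/-- The modified Jacobi theta function `θ(x; p) = (x; p)_∞ (p / x; p)_∞`, where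
`(x; p)_∞ = ∏_{k ≥ 0} (1 - x p ^ k)`. -/
noncomputable def theta (p x : ℂ) : ℂ :=
  (∏' k : ℕ, (1 - x * p ^ k)) * ∏' k : ℕ, (1 - p / x * p ^ k)

/-- The theta shifted factorial `(a; q, p)_n` for an integer `n`; in the case of
`Int.negSucc m` one has `n = -(m + 1)`. -/
noncomputable def thetaFactorial (q p a : ℂ) : ℤ → ℂ
  | Int.ofNat n => ∏ k ∈ Finset.range n, theta p (a * q ^ (k : ℤ))
  | Int.negSucc m =>
      1 / ∏ k ∈ Finset.range (m + 1), theta p (a * q ^ (-((m : ℤ) + 1) + (k : ℤ)))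

/-- The product `∏_{j = 1}^n f j` for an integer `n`, with the usual convention
`∏_{j = 1}^n f j = 1 / ∏_{j = n + 1}^0 f j` for `n < 0`. -/
noncomputable def prodOneTo (f : ℤ → ℂ) : ℤ → ℂ
  | Int.ofNat n => ∏ j ∈ Finset.range n, f ((j : ℤ) + 1)
  | Int.negSucc m => 1 / ∏ j ∈ Finset.range (m + 1), f (-(j : ℤ))

/-- The small elliptic weight `w_{a,b;q,p}(s,t)`. -/
noncomputable def smallWeight (q p a b : ℂ) (s t : ℤ) : ℂ :=
  (theta p (a * q ^ (s + 2 * t)) * theta p (b * q ^ (2 * s + t - 2)) *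
      theta p (a * q ^ (t - s - 1) / b)) /
    (theta p (a * q ^ (s + 2 * t - 2)) * theta p (b * q ^ (2 * s + t)) *
      theta p (a * q ^ (t - s + 1) / b)) * q

/-- The big elliptic weight `W_{a,b;q,p}(s,t) = ∏_{j = 1}^t w_{a,b;q,p}(s,j)`. -/
noncomputable def bigWeight (q p a b : ℂ) (s t : ℤ) : ℂ :=
  prodOneTo (fun j => smallWeight q p a b s j) t

/-- The shifted big elliptic weight `W^{(ρ)}_{a,b;q,p}(s,t)`. -/
noncomputable def shiftedBigWeight (q p a b : ℂ) (ρ s t : ℤ) : ℂ :=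
  bigWeight q p (a * q ^ (2 * ρ)) (b * q ^ (2 * ρ)) s t

/-- The big `Q`-weight
`Q_{a,b;q,p}(ℓ,ρ,s,t) = ∏_{i = 1}^ℓ W^{(ρ)}_{a,b;q,p}(i + s,t)`. -/
noncomputable def bigQWeight (q p a b : ℂ) (l ρ s t : ℤ) : ℂ :=
  prodOneTo (fun i => shiftedBigWeight q p a b ρ (i + s) t) l

/-- The partial sum `K_{i-1} = k_1 + ⋯ + k_{i-1}` (the terms strictly before `i`). -/
def sumBefore {r : ℕ} (k : Fin r → ℤ) (i : Fin r) : ℤ :=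
  ∑ ν ∈ Finset.univ.filter (fun ν => ν < i), k ν

/-- The partial sum `K_i = k_1 + ⋯ + k_i` (the terms up to and including `i`). -/
def sumUpTo {r : ℕ} (k : Fin r → ℤ) (i : Fin r) : ℤ :=
  ∑ ν ∈ Finset.univ.filter (fun ν => ν ≤ i), k ν

/-- The elliptic multinomial coefficient
`[k_1 + ⋯ + k_r; k_1, …, k_r]_{a_1,…,a_r;q,p}`; its upper entry is always the sum of
its lower entries. -/
noncomputable def ellMultinomial {r : ℕ} (q p : ℂ) (a : Fin r → ℂ) (k : Fin r → ℤ) : ℂ :=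
  thetaFactorial q p q (∑ i, k i) / (∏ i, thetaFactorial q p q (k i)) *
    (∏ i, thetaFactorial q p (a i * q ^ (1 + (∑ ν, k ν) - k i)) (k i) /
      thetaFactorial q p (a i * q ^ (1 + 2 * sumBefore k i)) (k i)) *
    ∏ i, ∏ j ∈ Finset.univ.filter (fun j => i < j),
      thetaFactorial q p (a i * q ^ (1 - k i) / a j) (k j) /
        thetaFactorial q p (a i * q / a j) (k j)

end EllMult

/-!
The elliptic multinomial coefficient is, up to the factors `∏ᵢ (aᵢ q^{1 + 2 K_{i-1}}; q, p)_{kᵢ}` in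
its denominator (`multDenom`), a simpler product `multNumer`. In the product of the `Q`-weights over
all pairs `i < j`, the theta functions that contain a single variable telescope, and what is left of
them is exactly the coboundary of `multDenom` (`prod_bigQWeight_eq`). Dividing it out, the claim
becomes a convolution for `multNumer`, whose weight `crossWeight` is a product over pairs of
functions of `aᵢ / aⱼ` alone.

`crossWeight` satisfies a cocycle relation (`crossWeight_cocycle`): removing the steps `e` and then
`k - e` from `n` carries the same weight as removing `e` from `k` and `k` from `n`. Hence the
convolution for a general `M` follows by induction from the case `M = 1`
(`multNumer_convolution`), as for weighted lattice paths that are cut after `M` steps.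

For `M = 1` (`multNumer_recurrence`) every summand is an explicit multiple of the left-hand side,
and the sum of these multiples is evaluated by the elliptic partial fraction identity of type `A`
(`sum_prod_theta_div_eq_zero`) with `r + 1` nodes. That identity is proved by induction on the
number of nodes: the addition formula for `θ` rewrites two factors of the numerator as a combination
of products that vanish at a node, which lowers the number of nodes by one. The addition formula
(`theta_addition`) expresses that the antisymmetric kernel `θ(xy) θ(x/y) / x` has rank two, so that
its Pfaffians vanish; the rank is read off from the Laurent expansion of `θ`, the Jacobi triple
product (`exists_theta_eq_tsum`), by splitting a double sum over `(m, n)` by the parity of `m + n`.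
-/

namespace EllMult

open Filter Topology

/-! ### The theta function: inversion, triple product, addition formula -/

lemma multipliable_one_sub_mul_pow {p : ℂ} (hp : ‖p‖ < 1) (z : ℂ) :
    Multipliable fun k : ℕ => 1 - z * p ^ k := by
  simp_rw [sub_eq_add_neg]
  apply multipliable_one_add_of_summable
  simpa using (summable_geometric_of_lt_one (norm_nonneg _) hp).mul_left ‖z‖

lemma theta_eq_one_sub_mul {p : ℂ} (hp : ‖p‖ < 1) (x : ℂ) :
    theta p x = (1 - x) * ((∏' k : ℕ, (1 - x * p ^ (k + 1))) *
      ∏' k : ℕ, (1 - x⁻¹ * p ^ (k + 1))) := by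
  have h : Multipliable fun k : ℕ => 1 - x * p ^ (k + 1) := by
    simpa [pow_succ', mul_assoc] using multipliable_one_sub_mul_pow hp (x * p)
  rw [theta, tprod_eq_zero_mul' (f := fun k : ℕ => 1 - x * p ^ k) h, pow_zero, mul_one, mul_assoc]
  congr 3
  funext k
  ring

lemma theta_one {p : ℂ} (hp : ‖p‖ < 1) : theta p 1 = 0 := by
  simp [theta_eq_one_sub_mul hp]

lemma theta_inv {p : ℂ} (hp : ‖p‖ < 1) {x : ℂ} (hx : x ≠ 0) :
    theta p x⁻¹ = -(theta p x / x) := by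
  rw [theta_eq_one_sub_mul hp, theta_eq_one_sub_mul hp x, inv_inv]
  field_simp
  ring

/-- The truncation of `theta p x` to the first `n` factors of each product. -/
noncomputable def thetaTrunc (p x : ℂ) (n : ℕ) : ℂ :=
  (∏ k ∈ Finset.range n, (1 - x * p ^ k)) * ∏ k ∈ Finset.range n, (1 - p / x * p ^ k)

lemma tendsto_thetaTrunc {p : ℂ} (hp : ‖p‖ < 1) (x : ℂ) :
    Tendsto (thetaTrunc p x) atTop (𝓝 (theta p x)) :=
  ((multipliable_one_sub_mul_pow hp x).hasProd.tendsto_prod_nat).mul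
    ((multipliable_one_sub_mul_pow hp (p / x)).hasProd.tendsto_prod_nat)

/-- The finite product `(p; p)_n`. -/
noncomputable def eulerProd (p : ℂ) (n : ℕ) : ℂ := ∏ k ∈ Finset.range n, (1 - p ^ (k + 1))

/-- The reciprocal `1 / (p; p)_n`, extended by `0` to negative `n`. With this extension the
recurrence `invEulerProd_sub_one` holds for all integers. -/
noncomputable def invEulerProd (p : ℂ) (n : ℤ) : ℂ := if n < 0 then 0 else (eulerProd p n.toNat)⁻¹

lemma one_sub_pow_ne_zero {p : ℂ} (hp : ‖p‖ < 1) (k : ℕ) : 1 - p ^ (k + 1) ≠ 0 := by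
  intro h
  have h1 : p ^ (k + 1) = 1 := (sub_eq_zero.mp h).symm
  have h2 : ‖p‖ ^ (k + 1) = 1 := by rw [← norm_pow, h1, norm_one]
  exact (pow_lt_one₀ (norm_nonneg _) hp (Nat.succ_ne_zero k)).ne h2

lemma eulerProd_ne_zero {p : ℂ} (hp : ‖p‖ < 1) (n : ℕ) : eulerProd p n ≠ 0 :=
  Finset.prod_ne_zero_iff.mpr fun k _ => one_sub_pow_ne_zero hp k

lemma exists_tendsto_eulerProd {p : ℂ} (hp : ‖p‖ < 1) :
    ∃ L : ℂ, L ≠ 0 ∧ Tendsto (eulerProd p) atTop (𝓝 L) := by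
  refine ⟨∏' k : ℕ, (1 - p ^ (k + 1)), ?_, ?_⟩
  · simp_rw [sub_eq_add_neg]
    refine tprod_one_add_ne_zero_of_summable (f := fun n ↦ -p ^ (n + 1)) ?_ ?_
    · intro k
      simpa [sub_eq_add_neg] using one_sub_pow_ne_zero hp k
    · simpa using (summable_nat_add_iff 1).mpr (summable_geometric_of_lt_one (norm_nonneg _) hp)
  · have h : Multipliable fun k : ℕ => 1 - p ^ (k + 1) := by
      simpa [pow_succ'] using multipliable_one_sub_mul_pow hp p
    exact h.hasProd.tendsto_prod_nat

lemma invEulerProd_sub_one {p : ℂ} (hp : ‖p‖ < 1) (n : ℤ) :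
    invEulerProd p (n - 1) = invEulerProd p n * (1 - p ^ n) := by
  rcases lt_trichotomy n 0 with h | h | h
  · simp [invEulerProd, h, show n - 1 < 0 by omega]
  · subst h; simp [invEulerProd]
  · obtain ⟨m, rfl⟩ : ∃ m : ℕ, n = m + 1 := ⟨(n - 1).toNat, by omega⟩
    have h1 : ((m : ℤ) + 1).toNat = m + 1 := by omega
    have h2 : ¬ ((m : ℤ) + 1 < 0) := by omega
    have h3 := one_sub_pow_ne_zero hp m
    have h4 : p ^ ((m : ℤ) + 1) = p ^ (m + 1) := by exact_mod_cast zpow_natCast p (m + 1)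
    have h5 := eulerProd_ne_zero hp m
    simp only [invEulerProd, add_sub_cancel_right, h1, h2, h4, if_false, Int.toNat_natCast,
      Int.not_ofNat_neg]
    rw [eulerProd, eulerProd, Finset.prod_range_succ, mul_inv, mul_assoc, inv_mul_cancel₀ h3,
      mul_one]

lemma exists_norm_invEulerProd_le {p : ℂ} (hp : ‖p‖ < 1) :
    ∃ C : ℝ, 0 ≤ C ∧ ∀ n, ‖invEulerProd p n‖ ≤ C := by
  obtain ⟨L, hL, hT⟩ := exists_tendsto_eulerProd hp
  obtain ⟨C, hC⟩ := (hT.inv₀ hL).norm.bddAbove_range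
  have h0 : 0 ≤ C := (norm_nonneg _).trans (hC ⟨0, rfl⟩)
  refine ⟨C, h0, fun n => ?_⟩
  unfold invEulerProd
  split_ifs
  · simpa using h0
  · exact hC ⟨n.toNat, rfl⟩

/-- The exponent `j (j - 1) / 2` of the theta series. -/
def tri (j : ℤ) : ℤ := j * (j - 1) / 2

lemma two_mul_tri (j : ℤ) : 2 * tri j = j * (j - 1) :=
  Int.mul_ediv_cancel' (Int.even_mul_pred_self j).two_dvd

lemma tri_add_one (j : ℤ) : tri (j + 1) = tri j + j := by
  have h1 := two_mul_tri j
  have h2 := two_mul_tri (j + 1)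
  linarith

/-- The `j`-th term of the theta series. -/
noncomputable def thetaTerm (p x : ℂ) (j : ℤ) : ℂ := (-1) ^ j * p ^ tri j * x ^ j

lemma thetaTerm_add_one {p x : ℂ} (hp0 : p ≠ 0) (hx : x ≠ 0) (j : ℤ) :
    thetaTerm p x (j + 1) = -(p ^ j * x) * thetaTerm p x j := by
  simp only [thetaTerm, tri_add_one, zpow_add₀ hp0, zpow_add_one₀ hx,
    zpow_add_one₀ (neg_ne_zero.mpr (one_ne_zero (α := ℂ)))]
  ring

/-- The finite form of the Jacobi triple product identity, a case of the `q`-binomial theorem. -/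
lemma hasSum_thetaTrunc {p x : ℂ} (hp : ‖p‖ < 1) (hp0 : p ≠ 0) (hx : x ≠ 0) (n : ℕ) :
    HasSum (fun j : ℤ => eulerProd p (2 * n) * invEulerProd p (n + j) * invEulerProd p (n - j) *
      thetaTerm p x j) (thetaTrunc p x n) := by
  induction n with
  | zero =>
    convert hasSum_single (f := fun j : ℤ => eulerProd p (2 * 0) * invEulerProd p ((0 : ℕ) + j) *
      invEulerProd p ((0 : ℕ) - j) * thetaTerm p x j) 0 ?_ using 1
    · simp [thetaTrunc, eulerProd, invEulerProd, thetaTerm, tri]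
    · intro j hj
      rcases lt_or_gt_of_ne hj with h | h
      · simp [invEulerProd, h]
      · simp [invEulerProd, h]
  | succ n ih =>
    set F : ℤ → ℂ := fun j => eulerProd p (2 * n) * invEulerProd p (n + j) *
      invEulerProd p (n - j) * thetaTerm p x j with hF
    have e1 : HasSum (fun j : ℤ => F (j - 1)) (thetaTrunc p x n) :=
      (Equiv.subRight (1 : ℤ)).hasSum_iff (f := F) |>.mpr ih
    have e2 : HasSum (fun j : ℤ => F (j + 1)) (thetaTrunc p x n) :=
      (Equiv.addRight (1 : ℤ)).hasSum_iff (f := F) |>.mpr ih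
    have key := ((ih.mul_left (1 + p ^ (2 * n + 1))).sub (e1.mul_left (x * p ^ n))).sub
      (e2.mul_left (p ^ (n + 1) / x))
    have hval : thetaTrunc p x (n + 1) = (1 + p ^ (2 * n + 1)) * thetaTrunc p x n -
        x * p ^ n * thetaTrunc p x n - p ^ (n + 1) / x * thetaTrunc p x n := by
      simp only [thetaTrunc, Finset.prod_range_succ]
      field_simp
      ring
    rw [hval]
    refine key.congr_fun fun j => ?_
    have hv : p ^ (n + 1 - j : ℤ) ≠ 0 := zpow_ne_zero _ hp0
    have hu : p ^ (n + 1 + j : ℤ) ≠ 0 := zpow_ne_zero _ hp0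
    have huv : p ^ (n + 1 + j : ℤ) * p ^ (n + 1 - j : ℤ) = p ^ (2 * n + 1 + 1) := by
      rw [← zpow_add₀ hp0, ← zpow_natCast]; congr 1; push_cast; ring
    have a1 : invEulerProd p (n + j) = invEulerProd p (n + 1 + j) * (1 - p ^ (n + 1 + j : ℤ)) := by
      rw [← invEulerProd_sub_one hp]; congr 1; ring
    have a2 : invEulerProd p (n - j) = invEulerProd p (n + 1 - j) * (1 - p ^ (n + 1 - j : ℤ)) := by
      rw [← invEulerProd_sub_one hp]; congr 1; ring
    have a3 : invEulerProd p (n + (j - 1)) = invEulerProd p (n + 1 + j) *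
        (1 - p ^ (n + 1 + j : ℤ)) * (1 - p ^ (n + 1 + j : ℤ) / p) := by
      rw [← a1, div_eq_mul_inv, ← zpow_sub_one₀ hp0, show (n + 1 + j - 1 : ℤ) = n + j by ring,
        ← invEulerProd_sub_one hp]; congr 1; ring
    have a4 : invEulerProd p (n - (j + 1)) = invEulerProd p (n + 1 - j) *
        (1 - p ^ (n + 1 - j : ℤ)) * (1 - p ^ (n + 1 - j : ℤ) / p) := by
      rw [← a2, div_eq_mul_inv, ← zpow_sub_one₀ hp0, show (n + 1 - j - 1 : ℤ) = n - j by ring,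
        ← invEulerProd_sub_one hp]; congr 1; ring
    have a5 : eulerProd p (2 * (n + 1)) = eulerProd p (2 * n) * (1 - p ^ (2 * n + 1)) *
        (1 - p ^ (2 * n + 1 + 1)) := by
      rw [show 2 * (n + 1) = 2 * n + 1 + 1 by ring, eulerProd, eulerProd, Finset.prod_range_succ,
        Finset.prod_range_succ]
    have a6 : p ^ (2 * n + 1) = p ^ (2 * n + 1 + 1) / p := by
      rw [pow_succ _ (2 * n + 1)]; field_simp
    have t1 : x * p ^ n * thetaTerm p x (j - 1) = -(p ^ (n + 1 - j : ℤ) * thetaTerm p x j) := by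
      have := thetaTerm_add_one hp0 hx (j - 1)
      rw [sub_add_cancel] at this
      rw [this, ← zpow_natCast p n, show (n + 1 - j : ℤ) = n - (j - 1) by ring, zpow_sub₀ hp0]
      have := zpow_ne_zero (j - 1) hp0
      field_simp
    have t2 : p ^ (n + 1) / x * thetaTerm p x (j + 1) =
        -(p ^ (n + 1 + j : ℤ) * thetaTerm p x j) := by
      rw [thetaTerm_add_one hp0 hx, zpow_add₀ hp0, ← zpow_natCast p (n + 1)]
      push_cast
      field_simp
    have s1 : x * p ^ n * F (j - 1) = -(eulerProd p (2 * n) * invEulerProd p (n + (j - 1)) *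
        invEulerProd p (n + 1 - j) * (p ^ (n + 1 - j : ℤ) * thetaTerm p x j)) := by
      rw [hF]
      simp only
      rw [show (n - (j - 1) : ℤ) = n + 1 - j by ring]
      linear_combination (eulerProd p (2 * n) * invEulerProd p (n + (j - 1)) *
        invEulerProd p (n + 1 - j)) * t1
    have s2 : p ^ (n + 1) / x * F (j + 1) = -(eulerProd p (2 * n) * invEulerProd p (n + 1 + j) *
        invEulerProd p (n - (j + 1)) * (p ^ (n + 1 + j : ℤ) * thetaTerm p x j)) := by
      rw [hF]
      simp only
      rw [show (n + (j + 1) : ℤ) = n + 1 + j by ring]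
      linear_combination (eulerProd p (2 * n) * invEulerProd p (n + 1 + j) *
        invEulerProd p (n - (j + 1))) * t2
    rw [s1, s2, hF]
    simp only
    rw [a1, a2, a3, a4, a5, a6, ← huv]
    push_cast
    generalize p ^ (n + 1 - j : ℤ) = v at *
    generalize p ^ (n + 1 + j : ℤ) = u at *
    field_simp
    ring

lemma summable_pow_mul_pow {p : ℝ} (hp0 : 0 < p) (hp : p < 1) {x : ℝ} (hx : 0 < x) :
    Summable fun n : ℕ => p ^ tri n * x ^ n := by
  refine summable_of_ratio_test_tendsto_lt_one zero_lt_one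
    (.of_forall fun n => (mul_pos (zpow_pos hp0 _) (pow_pos hx _)).ne') ?_
  have : Tendsto (fun n : ℕ => p ^ n * x) atTop (𝓝 0) := by
    simpa using (tendsto_pow_atTop_nhds_zero_of_lt_one hp0.le hp).mul_const x
  refine this.congr fun n => ?_
  rw [Real.norm_of_nonneg (mul_pos (zpow_pos hp0 _) (pow_pos hx _)).le,
    Real.norm_of_nonneg (mul_pos (zpow_pos hp0 _) (pow_pos hx _)).le]
  push_cast
  rw [tri_add_one, zpow_add₀ hp0.ne', zpow_natCast, pow_succ]
  have := (zpow_pos hp0 (tri n)).ne'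
  field_simp

lemma summable_norm_thetaTerm {p x : ℂ} (hp : ‖p‖ < 1) (hp0 : p ≠ 0) (hx : x ≠ 0) :
    Summable fun j : ℤ => ‖thetaTerm p x j‖ := by
  have h0 : 0 < ‖p‖ := norm_pos_iff.mpr hp0
  have h1 : 0 < ‖x‖ := norm_pos_iff.mpr hx
  refine Summable.of_nat_of_neg ?_ ?_
  · refine (summable_pow_mul_pow h0 hp h1).congr fun n => ?_
    simp [thetaTerm]
  · refine (summable_pow_mul_pow h0 hp (div_pos h0 h1)).congr fun n => ?_
    have : tri (-n) = tri n + n := by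
      have h1 := two_mul_tri n
      have h2 := two_mul_tri (-n)
      linarith
    simp only [thetaTerm, norm_mul, norm_zpow, norm_neg, norm_one, one_mul, this,
      zpow_add₀ h0.ne', zpow_neg, zpow_natCast, div_pow, norm_inv, norm_pow, one_pow, inv_one]
    ring

/-- The Jacobi triple product identity, up to the value of the normalizing constant. -/
theorem exists_theta_eq_tsum {p : ℂ} (hp : ‖p‖ < 1) (hp0 : p ≠ 0) :
    ∃ c : ℂ, ∀ x : ℂ, x ≠ 0 → theta p x = c * ∑' j : ℤ, thetaTerm p x j := by
  obtain ⟨L, hL, hT⟩ := exists_tendsto_eulerProd hp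
  obtain ⟨C, hC0, hC⟩ := exists_norm_invEulerProd_le hp
  obtain ⟨D, hD⟩ := hT.norm.bddAbove_range
  have hI : Tendsto (invEulerProd p) atTop (𝓝 L⁻¹) := by
    have h1 : Tendsto (fun n : ℤ => (eulerProd p n.toNat)⁻¹) atTop (𝓝 L⁻¹) := by
      refine (hT.inv₀ hL).comp ?_
      exact tendsto_atTop.mpr fun b => (eventually_ge_atTop (b : ℤ)).mono fun n hn => by omega
    refine h1.congr' ((eventually_ge_atTop 0).mono fun n hn => ?_)
    rw [invEulerProd, if_neg (by omega)]
  refine ⟨L * L⁻¹ * L⁻¹, fun x hx => ?_⟩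
  rw [← tsum_mul_left]
  refine tendsto_nhds_unique (tendsto_thetaTrunc hp x) ?_
  refine Tendsto.congr (fun n => (hasSum_thetaTrunc hp hp0 hx n).tsum_eq) ?_
  refine tendsto_tsum_of_dominated_convergence
    (bound := fun j => D * C * C * ‖thetaTerm p x j‖)
    ((summable_norm_thetaTerm hp hp0 hx).mul_left _) (fun j => ?_) (.of_forall fun n j => ?_)
  · refine Tendsto.mul_const _ (((hT.comp ?_).mul (hI.comp ?_)).mul (hI.comp ?_))
    · exact tendsto_atTop.mpr fun b => (eventually_ge_atTop b).mono fun n hn => by omega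
    · exact tendsto_atTop.mpr fun b =>
        (eventually_ge_atTop (b - j).toNat).mono fun n hn => by omega
    · exact tendsto_atTop.mpr fun b =>
        (eventually_ge_atTop (b + j).toNat).mono fun n hn => by omega
  · simp only [norm_mul]
    have hD0 : ‖eulerProd p (2 * n)‖ ≤ D := hD ⟨2 * n, rfl⟩
    have : 0 ≤ D := (norm_nonneg _).trans hD0
    gcongr
    · exact hC _
    · exact hC _

/-- The bijection `ℤ × ℤ ≃ {0, 1} × ℤ × ℤ` that splits pairs `(m, n)` by the parity of `m + n`:
`m = s + d + ε` and `n = s - d`. -/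
def parityEquiv : Bool × ℤ × ℤ ≃ ℤ × ℤ where
  toFun t := (t.2.1 + t.2.2 + (if t.1 then 1 else 0), t.2.1 - t.2.2)
  invFun m := (decide ((m.1 + m.2) % 2 = 1), (m.1 + m.2) / 2, (m.1 - m.2) / 2)
  left_inv := by
    rintro ⟨ε, s, d⟩
    cases ε <;> simp <;> omega
  right_inv := by
    rintro ⟨m, n⟩
    by_cases h : (m + n) % 2 = 1 <;> simp [h] <;> omega

lemma thetaTerm_mul_thetaTerm {p x y : ℂ} (hp0 : p ≠ 0) (hx : x ≠ 0) (hy : y ≠ 0) (s d e : ℤ) :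
    thetaTerm p (x * y) (s + d + e) * thetaTerm p (x / y) (s - d) =
      (-1) ^ e * p ^ tri e * ((p ^ (s * (s + e - 1)) * x ^ (2 * s + e)) *
        (p ^ (d * (d + e)) * y ^ (2 * d + e))) := by
  have h1 : tri (s + d + e) + tri (s - d) = tri e + s * (s + e - 1) + d * (d + e) := by
    have h1 := two_mul_tri (s + d + e)
    have h2 := two_mul_tri (s - d)
    have h3 := two_mul_tri e
    linarith
  have h2 : ((-1 : ℂ)) ^ (s + d + e) * (-1) ^ (s - d) = (-1) ^ e := by
    rw [← zpow_add₀ (by norm_num), show s + d + e + (s - d) = 2 * s + e by ring,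
      zpow_add₀ (by norm_num), zpow_mul]
    simp
  have h3 : (x * y) ^ (s + d + e) * (x / y) ^ (s - d) = x ^ (2 * s + e) * y ^ (2 * d + e) := by
    rw [mul_zpow, div_eq_mul_inv, mul_zpow, inv_zpow', show 2 * s + e = (s + d + e) + (s - d) by ring,
      zpow_add₀ hx (s + d + e), show 2 * d + e = (s + d + e) + -(s - d) by ring,
      zpow_add₀ hy (s + d + e)]
    ring
  calc _ = ((-1 : ℂ) ^ (s + d + e) * (-1) ^ (s - d)) * (p ^ tri (s + d + e) * p ^ tri (s - d)) *
        ((x * y) ^ (s + d + e) * (x / y) ^ (s - d)) := by simp only [thetaTerm]; ring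
    _ = _ := by
      rw [h2, h3, ← zpow_add₀ hp0, h1, zpow_add₀ hp0, zpow_add₀ hp0]; ring

lemma summable_norm_zpow_mul_zpow {p y : ℂ} (hp : ‖p‖ < 1) (hp0 : p ≠ 0) (hy : y ≠ 0)
    (e f : ℤ) : Summable fun d : ℤ => ‖p ^ (d * (d + e)) * y ^ (2 * d + f)‖ := by
  have hp2 : ‖p ^ 2‖ < 1 := by
    rw [norm_pow]
    exact pow_lt_one₀ (norm_nonneg _) hp two_ne_zero
  refine ((summable_norm_thetaTerm hp2 (pow_ne_zero 2 hp0)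
    (x := p ^ (e + 1) * y ^ 2) (by positivity)).mul_left ‖y ^ f‖).congr fun d => ?_
  have h1 : d * (d + e) = 2 * tri d + (e + 1) * d := by rw [two_mul_tri]; ring
  rw [h1, zpow_add₀ hp0 (2 * tri d), zpow_add₀ hy, thetaTerm, mul_zpow, ← zpow_mul,
    ← zpow_natCast p, ← zpow_natCast y, ← zpow_mul, ← zpow_mul]
  simp only [norm_mul, norm_zpow, norm_neg, norm_one, one_zpow, one_mul]
  push_cast
  ring

/-- The kernel `θ(xy) θ(x/y)` has rank two. This is the source of the addition formula. -/
lemma exists_theta_mul_theta_rank_two {p : ℂ} (hp : ‖p‖ < 1) :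
    ∃ A B A' B' : ℂ → ℂ, ∀ x y : ℂ, x ≠ 0 → y ≠ 0 →
      theta p (x * y) * theta p (x / y) = A x * B y + A' x * B' y := by
  by_cases hp0 : p = 0
  · -- here `θ(x) = 1 - x`
    subst hp0
    refine ⟨fun x => 1 + x ^ 2, fun _ => 1, fun x => -x, fun y => y + y⁻¹, fun x y hx hy => ?_⟩
    simp only [theta_eq_one_sub_mul hp, pow_succ, mul_zero, sub_zero, tprod_one, mul_one]
    field_simp
    ring
  obtain ⟨c, hc⟩ := exists_theta_eq_tsum hp hp0
  refine ⟨fun x => c ^ 2 * ∑' s : ℤ, p ^ (s * (s + 0 - 1)) * x ^ (2 * s + 0),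
    fun y => ∑' d : ℤ, p ^ (d * (d + 0)) * y ^ (2 * d + 0),
    fun x => -c ^ 2 * ∑' s : ℤ, p ^ (s * (s + 1 - 1)) * x ^ (2 * s + 1),
    fun y => ∑' d : ℤ, p ^ (d * (d + 1)) * y ^ (2 * d + 1), fun x y hx hy => ?_⟩
  have hxy : x * y ≠ 0 := mul_ne_zero hx hy
  have hxy' : x / y ≠ 0 := div_ne_zero hx hy
  have n1 := summable_norm_thetaTerm hp hp0 hxy
  have n2 := summable_norm_thetaTerm hp hp0 hxy'
  have hs := summable_mul_of_summable_norm n1 n2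
  have hs' := parityEquiv.summable_iff.mpr hs
  simp only [Function.comp_def] at hs'
  have split : ∀ e : ℤ, ∑' sd : ℤ × ℤ, thetaTerm p (x * y) (sd.1 + sd.2 + e) *
      thetaTerm p (x / y) (sd.1 - sd.2) = (-1) ^ e * p ^ tri e *
        ((∑' s : ℤ, p ^ (s * (s + e - 1)) * x ^ (2 * s + e)) *
          ∑' d : ℤ, p ^ (d * (d + e)) * y ^ (2 * d + e)) := by
    intro e
    have hS : Summable fun s : ℤ => ‖p ^ (s * (s + e - 1)) * x ^ (2 * s + e)‖ := by
      simpa only [add_sub_assoc] using summable_norm_zpow_mul_zpow hp hp0 hx (e - 1) e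
    have hD : Summable fun d : ℤ => ‖p ^ (d * (d + e)) * y ^ (2 * d + e)‖ :=
      summable_norm_zpow_mul_zpow hp hp0 hy e e
    rw [tsum_mul_tsum_of_summable_norm hS hD, ← tsum_mul_left]
    exact tsum_congr fun sd => thetaTerm_mul_thetaTerm hp0 hx hy sd.1 sd.2 e
  rw [hc _ hxy, hc _ hxy', mul_mul_mul_comm, tsum_mul_tsum_of_summable_norm n1 n2,
    ← parityEquiv.tsum_eq, hs'.tsum_prod,
    tsum_fintype, Fintype.sum_bool]
  have e1 := split 1
  have e0 := split 0
  simp only [parityEquiv, Equiv.coe_fn_mk, if_true, Bool.false_eq_true, if_false] at e1 e0 ⊢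
  rw [e1, e0]
  simp [tri]
  ring

/-- The three-term relation of Weierstrass and Riemann in Pfaffian form: an antisymmetric kernel of
rank two has vanishing Pfaffians. -/
theorem theta_addition {p : ℂ} (hp : ‖p‖ < 1) {x y u v : ℂ} (hx : x ≠ 0) (hy : y ≠ 0)
    (hu : u ≠ 0) (hv : v ≠ 0) :
    (theta p (x * y) * theta p (x / y) / x) * (theta p (u * v) * theta p (u / v) / u) -
      (theta p (x * u) * theta p (x / u) / x) * (theta p (y * v) * theta p (y / v) / y) +
      (theta p (x * v) * theta p (x / v) / x) * (theta p (y * u) * theta p (y / u) / y) = 0 := by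
  obtain ⟨A, B, A', B', h⟩ := exists_theta_mul_theta_rank_two hp
  set k : ℂ → ℂ → ℂ := fun s t => theta p (s * t) * theta p (s / t) / s with hk
  have hr : ∀ s t, s ≠ 0 → t ≠ 0 → k s t = A s / s * B t + A' s / s * B' t := by
    intro s t hs ht
    simp only [hk, h s t hs ht]
    ring
  have ha : ∀ s t, s ≠ 0 → t ≠ 0 → k s t = -k t s := by
    intro s t hs ht
    simp only [hk]
    rw [← inv_div t s, theta_inv hp (div_ne_zero ht hs), mul_comm s t]
    field_simp
  have hz : ∀ s, s ≠ 0 → k s s = 0 := fun s hs => by simp [hk, div_self hs, theta_one hp]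
  -- all minors of size three of the kernel vanish
  have minor : ∀ s₁ s₂ s₃ t₁ t₂ t₃, s₁ ≠ 0 → s₂ ≠ 0 → s₃ ≠ 0 → t₁ ≠ 0 → t₂ ≠ 0 → t₃ ≠ 0 →
      k s₁ t₁ * (k s₂ t₂ * k s₃ t₃ - k s₂ t₃ * k s₃ t₂) -
      k s₁ t₂ * (k s₂ t₁ * k s₃ t₃ - k s₂ t₃ * k s₃ t₁) +
      k s₁ t₃ * (k s₂ t₁ * k s₃ t₂ - k s₂ t₂ * k s₃ t₁) = 0 := by
    intro s₁ s₂ s₃ t₁ t₂ t₃ h1 h2 h3 h4 h5 h6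
    rw [hr s₁ t₁ h1 h4, hr s₁ t₂ h1 h5, hr s₁ t₃ h1 h6, hr s₂ t₁ h2 h4, hr s₂ t₂ h2 h5,
      hr s₂ t₃ h2 h6, hr s₃ t₁ h3 h4, hr s₃ t₂ h3 h5, hr s₃ t₃ h3 h6]
    ring
  change k x y * k u v - k x u * k y v + k x v * k y u = 0
  have m1 := minor x y u x y v hx hy hu hx hy hv
  have m2 := minor x y u x u v hx hy hu hx hu hv
  have m3 := minor x y v x u v hx hy hv hx hu hv
  rw [hz x hx, hz y hy, ha y x hy hx, ha u x hu hx, ha u y hu hy] at m1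
  rw [hz x hx, hz u hu, ha y x hy hx, ha u x hu hx] at m2
  rw [hz x hx, hz v hv, ha y x hy hx, ha v x hv hx, ha v u hv hu] at m3
  refine pow_eq_zero_iff two_ne_zero |>.mp ?_
  linear_combination k u v * m1 - k y v * m2 + k y u * m3

/-- The zeros of the theta function are the integral powers of `p`. -/
lemma theta_eq_zero_iff {p x : ℂ} (hp : ‖p‖ < 1) (hx : x ≠ 0) :
    theta p x = 0 ↔ ∃ k : ℕ, x * p ^ k = 1 ∨ x = p ^ k := by
  have key : ∀ z : ℂ, ∏' k : ℕ, (1 - z * p ^ k) = 0 ↔ ∃ k : ℕ, z * p ^ k = 1 := by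
    intro z
    constructor
    · intro h
      by_contra! hz
      refine tprod_one_add_ne_zero_of_summable (f := fun k : ℕ => -(z * p ^ k)) ?_ ?_ ?_
      · intro k hk
        exact hz k (by linear_combination -hk)
      · simpa using (summable_geometric_of_lt_one (norm_nonneg _) hp).mul_left ‖z‖
      · simpa [sub_eq_add_neg] using h
    · rintro ⟨k, hk⟩
      exact tprod_of_exists_eq_zero ⟨k, by rw [hk, sub_self]⟩
  rw [theta, mul_eq_zero, key, key]
  constructor
  · rintro (⟨k, hk⟩ | ⟨k, hk⟩)
    · exact ⟨k, Or.inl hk⟩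
    · refine ⟨k + 1, Or.inr ?_⟩
      field_simp at hk
      rw [← hk]
      ring
  · rintro ⟨k, hk | hk⟩
    · exact Or.inl ⟨k, hk⟩
    · cases k with
      | zero => exact Or.inl ⟨0, by simpa using hk⟩
      | succ k =>
        refine Or.inr ⟨k, ?_⟩
        field_simp
        rw [hk]
        ring

lemma theta_div_eq_zero {p u v : ℂ} (hp : ‖p‖ < 1) (hu : u ≠ 0) (hv : v ≠ 0)
    (h1 : theta p u = 0) (h2 : theta p v = 0) : theta p (u / v) = 0 := by
  rw [theta_eq_zero_iff hp hu] at h1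
  rw [theta_eq_zero_iff hp hv] at h2
  rw [theta_eq_zero_iff hp (div_ne_zero hu hv)]
  obtain ⟨i, hi⟩ := h1
  obtain ⟨j, hj⟩ := h2
  rcases hi with hi | hi <;> rcases hj with hj | hj
  · have hpi : p ^ i ≠ 0 := right_ne_zero_of_mul_eq_one hi
    have hpj : p ^ j ≠ 0 := right_ne_zero_of_mul_eq_one hj
    rcases le_total i j with h | h
    · obtain ⟨d, rfl⟩ := Nat.exists_eq_add_of_le h
      refine ⟨d, Or.inr ?_⟩
      rw [div_eq_iff hv]
      refine mul_right_cancel₀ hpi ?_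
      rw [hi, ← hj]; ring
    · obtain ⟨d, rfl⟩ := Nat.exists_eq_add_of_le h
      refine ⟨d, Or.inl ?_⟩
      rw [div_mul_eq_mul_div, div_eq_iff hv]
      refine mul_right_cancel₀ hpj ?_
      rw [one_mul, hj, ← hi]; ring
  · refine ⟨i + j, Or.inl ?_⟩
    rw [hj] at hv ⊢
    field_simp
    rw [pow_add, ← mul_assoc, hi, one_mul]
  · refine ⟨i + j, Or.inr ?_⟩
    rw [div_eq_iff hv, hi]
    linear_combination (-p ^ i) * hj
  · rcases le_total i j with h | h
    · obtain ⟨d, rfl⟩ := Nat.exists_eq_add_of_le h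
      refine ⟨d, Or.inl ?_⟩
      rw [hj] at hv ⊢
      rw [hi] at hu ⊢
      field_simp
      ring
    · obtain ⟨d, rfl⟩ := Nat.exists_eq_add_of_le h
      refine ⟨d, Or.inr ?_⟩
      rw [div_eq_iff hv, hi, hj]
      ring

/-! ### Elliptic partial fractions -/

/-- The addition formula as a change of basis: `θ(t/y₁) θ(t/y₂)` is a combination of two products
with the same norm `y₁ y₂`, having zeros at `z` and `w` respectively. -/
lemma exists_theta_div_mul_theta_div_eq {p : ℂ} (hp : ‖p‖ < 1) {y₁ y₂ z w : ℂ} (hy₁ : y₁ ≠ 0)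
    (hy₂ : y₂ ≠ 0) (hz : z ≠ 0) (hw : w ≠ 0) (h1 : theta p (z / w) ≠ 0)
    (h2 : theta p (z * w / (y₁ * y₂)) ≠ 0) :
    ∃ α β : ℂ, ∀ t : ℂ, t ≠ 0 → theta p (t / y₁) * theta p (t / y₂) =
      α * (theta p (t / z) * theta p (t / (y₁ * y₂ / z))) +
      β * (theta p (t / w) * theta p (t / (y₁ * y₂ / w))) := by
  obtain ⟨c, hc⟩ := IsAlgClosed.exists_pow_nat_eq (y₁ * y₂) (n := 2) two_pos
  have hc0 : c ≠ 0 := by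
    rintro rfl
    exact mul_ne_zero hy₁ hy₂ (by simpa using hc.symm)
  have hy2 : y₂ = c ^ 2 / y₁ := by rw [hc]; field_simp
  rw [← hc] at h2 ⊢
  have hK : theta p (z / c * (w / c)) * theta p (z / c / (w / c)) / (z / c) ≠ 0 := by
    refine div_ne_zero (mul_ne_zero ?_ ?_) (div_ne_zero hz hc0)
    · rwa [show z / c * (w / c) = z * w / c ^ 2 by field_simp]
    · rwa [div_div_div_cancel_right₀ hc0]
  set K := theta p (z / c * (w / c)) * theta p (z / c / (w / c)) / (z / c) with hKdef
  set B := theta p (y₁ / c * (w / c)) * theta p (y₁ / c / (w / c)) / (y₁ / c) with hB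
  set D := theta p (y₁ / c * (z / c)) * theta p (y₁ / c / (z / c)) / (y₁ / c) with hD
  refine ⟨B / K, -(D / K), fun t ht => ?_⟩
  have key := theta_addition hp (div_ne_zero ht hc0) (div_ne_zero hy₁ hc0) (div_ne_zero hz hc0)
    (div_ne_zero hw hc0)
  have e : ∀ s, s ≠ 0 → theta p (t / c * (s / c)) * theta p (t / c / (s / c)) =
      theta p (t / s) * theta p (t / (c ^ 2 / s)) := by
    intro s hs
    rw [mul_comm, div_div_div_cancel_right₀ hc0]
    congr 2
    field_simp
  rw [e y₁ hy₁, e z hz, e w hw, ← hKdef, ← hB, ← hD] at key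
  rw [hy2]
  clear_value K B D
  field_simp at key ⊢
  rw [mul_zero] at key
  linear_combination (mul_eq_zero.mp key).resolve_left hc0

/-- The elliptic partial fraction identity of type `A`. -/
theorem sum_prod_theta_div_eq_zero {ι : Type*} [DecidableEq ι] {p : ℂ} (hp : ‖p‖ < 1)
    (x : ι → ℂ) (S : Finset ι) (hx : ∀ i ∈ S, x i ≠ 0)
    (hxx : ∀ i ∈ S, ∀ j ∈ S, i ≠ j → theta p (x i / x j) ≠ 0)
    (Y : Multiset ℂ) (hY : ∀ y ∈ Y, y ≠ 0) (hcard : Y.card = S.card)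
    (hprod : Y.prod = ∏ i ∈ S, x i) :
    ∑ i ∈ S, (Y.map fun y => theta p (x i / y)).prod / ∏ j ∈ S.erase i, theta p (x i / x j) = 0 := by
  induction hs : S.card generalizing S Y with
  | zero => simp [Finset.card_eq_zero.mp hs]
  | succ s ih =>
    -- removing a factor that vanishes at `x l` reduces the sum to `S.erase l`
    have reduce : ∀ l ∈ S, ∀ Z : Multiset ℂ, (∀ y ∈ Z, y ≠ 0) → Z.card = s →
        x l * Z.prod = ∏ i ∈ S, x i →
        ∑ i ∈ S, theta p (x i / x l) * (Z.map fun y => theta p (x i / y)).prod /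
          ∏ j ∈ S.erase i, theta p (x i / x j) = 0 := by
      intro l hl Z hZ hZc hZp
      have hlS : (S.erase l).card = s := by rw [Finset.card_erase_of_mem hl, hs]; simp
      rw [← ih (S.erase l) (fun i hi => hx i (Finset.mem_of_mem_erase hi))
        (fun i hi j hj => hxx i (Finset.mem_of_mem_erase hi) j (Finset.mem_of_mem_erase hj)) Z hZ
        (hZc.trans hlS.symm) ?_ hlS, ← Finset.add_sum_erase S _ hl, div_self (hx l hl),
        theta_one hp, zero_mul, zero_div, zero_add]
      · refine Finset.sum_congr rfl fun i hi => ?_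
        have hil := Finset.ne_of_mem_erase hi
        have hiS := Finset.mem_of_mem_erase hi
        rw [← Finset.mul_prod_erase (S.erase i) _ (Finset.mem_erase.mpr ⟨hil.symm, hl⟩),
          mul_div_mul_left _ _ (hxx i hiS l hl hil), Finset.erase_right_comm]
      · rw [← Finset.mul_prod_erase S x hl] at hZp
        exact mul_left_cancel₀ (hx l hl) hZp
    have hYc : Y.card = s + 1 := hcard.trans hs
    obtain ⟨y₁, Y', rfl⟩ : ∃ y Y', Y = y ::ₘ Y' :=
      (Multiset.card_pos_iff_exists_mem.mp (by omega)).imp fun y hy => Multiset.exists_cons_of_mem hy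
    have hy₁ := hY y₁ (Multiset.mem_cons_self _ _)
    rcases Nat.eq_zero_or_pos s with rfl | hspos
    · obtain ⟨l, rfl⟩ := Finset.card_eq_one.mp hs
      have : Y' = 0 := by simpa using hYc
      subst this
      have : y₁ = x l := by simpa using hprod
      subst this
      simp [div_self hy₁, theta_one hp]
    obtain ⟨y₂, Y, rfl⟩ : ∃ y Y'', Y' = y ::ₘ Y'' :=
      (Multiset.card_pos_iff_exists_mem.mp (by simp at hYc; omega)).imp
        fun y hy => Multiset.exists_cons_of_mem hy
    have hy₂ := hY y₂ (Multiset.mem_cons_of_mem (Multiset.mem_cons_self _ _))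
    have hYc' : Y.card + 1 = s := by simpa using hYc
    have hYn : ∀ y ∈ Y, y ≠ 0 := fun y hy =>
      hY y (Multiset.mem_cons_of_mem (Multiset.mem_cons_of_mem hy))
    simp only [Multiset.prod_cons] at hprod
    -- it suffices to find two distinct nodes at which the change of basis is nondegenerate
    suffices h : (∃ k ∈ S, ∃ l ∈ S, k ≠ l ∧ theta p (x k * x l / (y₁ * y₂)) ≠ 0) ∨
        ∑ i ∈ S, ((y₁ ::ₘ y₂ ::ₘ Y).map fun y => theta p (x i / y)).prod /
          ∏ j ∈ S.erase i, theta p (x i / x j) = 0 by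
      rcases h with ⟨k, hk, l, hl, hkl, h⟩ | h
      · obtain ⟨α, β, hαβ⟩ := exists_theta_div_mul_theta_div_eq hp hy₁ hy₂ (hx k hk) (hx l hl)
          (hxx k hk l hl hkl) h
        have r : ∀ m ∈ S, ∑ i ∈ S, theta p (x i / x m) *
            (((y₁ * y₂ / x m) ::ₘ Y).map fun y => theta p (x i / y)).prod /
              ∏ j ∈ S.erase i, theta p (x i / x j) = 0 := by
          intro m hm
          refine reduce m hm _ ?_ (by simpa using hYc') ?_
          · intro y hy
            rcases Multiset.mem_cons.mp hy with rfl | hy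
            · exact div_ne_zero (mul_ne_zero hy₁ hy₂) (hx m hm)
            · exact hYn y hy
          · rw [Multiset.prod_cons, ← hprod]
            have := hx m hm
            field_simp
        calc _ = α * (∑ i ∈ S, theta p (x i / x k) *
              (((y₁ * y₂ / x k) ::ₘ Y).map fun y => theta p (x i / y)).prod /
                ∏ j ∈ S.erase i, theta p (x i / x j)) +
              β * (∑ i ∈ S, theta p (x i / x l) *
              (((y₁ * y₂ / x l) ::ₘ Y).map fun y => theta p (x i / y)).prod /
                ∏ j ∈ S.erase i, theta p (x i / x j)) := by
              rw [Finset.mul_sum, Finset.mul_sum, ← Finset.sum_add_distrib]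
              refine Finset.sum_congr rfl fun i hi => ?_
              simp only [Multiset.map_cons, Multiset.prod_cons]
              rw [← mul_assoc, hαβ (x i) (hx i hi)]
              ring
          _ = 0 := by rw [r k hk, r l hl, mul_zero, mul_zero, add_zero]
      · exact h
    rcases Nat.lt_or_ge s 2 with h2 | h2
    · right
      obtain rfl : s = 1 := by omega
      obtain ⟨k, l, hkl, rfl⟩ := Finset.card_eq_two.mp hs
      have : Y = 0 := by simpa using hYc'
      subst this
      have hxk := hx k (by simp)
      have hxl := hx l (by simp)
      have hkl' : theta p (x k / x l) ≠ 0 := hxx k (by simp) l (by simp) hkl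
      rw [Finset.prod_pair hkl, Multiset.prod_zero, mul_one] at hprod
      rw [Finset.sum_pair hkl, Finset.erase_insert (by simpa using hkl),
        show ({k, l} : Finset ι).erase l = {k} by
          rw [Finset.pair_comm, Finset.erase_insert (by simpa using hkl.symm)]]
      have e1 : x k / y₁ = (x l / y₂)⁻¹ := by
        field_simp
        linear_combination -hprod
      have e2 : x k / y₂ = (x l / y₁)⁻¹ := by
        field_simp
        linear_combination -hprod
      have e3 : theta p (x l / x k) = -(theta p (x k / x l) / (x k / x l)) := by
        rw [← inv_div (x k), theta_inv hp (div_ne_zero hxk hxl)]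
      simp only [Multiset.map_cons, Multiset.prod_cons, Multiset.map_zero, Multiset.prod_zero,
        mul_one, Finset.prod_singleton]
      rw [e3, e1, e2, theta_inv hp (div_ne_zero hxl hy₂), theta_inv hp (div_ne_zero hxl hy₁)]
      field_simp
      linear_combination (theta p (x l / y₁) * theta p (x l / y₂)) * hprod
    · left
      -- for three nodes `x i`, `x j`, `x k`, degeneracy at both `(i, j)` and `(i, k)` would make
      -- `x j / x k` a zero of the theta function
      obtain ⟨i, j, k, hi, hj, hk, hij, hik, hjk⟩ := Finset.two_lt_card_iff.mp (by omega : 2 < S.card)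
      by_contra! hcon
      have h12 := hcon i hi j hj hij
      have h13 := hcon i hi k hk hik
      have hxi := hx i hi
      have hxj := hx j hj
      have hxk := hx k hk
      refine hxx j hj k hk hjk ?_
      have := theta_div_eq_zero hp (div_ne_zero (mul_ne_zero hxi hxj) (mul_ne_zero hy₁ hy₂))
        (div_ne_zero (mul_ne_zero hxi hxk) (mul_ne_zero hy₁ hy₂)) h12 h13
      rwa [div_div_div_cancel_right₀ (mul_ne_zero hy₁ hy₂), mul_div_mul_left _ _ hxi] at this

/-- The elliptic partial fraction identity with nodes and zeros indexed by a finite type. -/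
lemma sum_univ_prod_theta_div_eq_zero {ι : Type*} [Fintype ι] [DecidableEq ι] {p : ℂ}
    (hp : ‖p‖ < 1) (x y : ι → ℂ) (hx : ∀ i, x i ≠ 0) (hy : ∀ i, y i ≠ 0)
    (hxx : ∀ i j, i ≠ j → theta p (x i / x j) ≠ 0) (hprod : ∏ i, y i = ∏ i, x i) :
    ∑ i, (∏ j, theta p (x i / y j)) / ∏ j, (if j = i then 1 else theta p (x i / x j)) = 0 := by
  have h := sum_prod_theta_div_eq_zero hp x Finset.univ (fun i _ => hx i)
    (fun i _ j _ => hxx i j) (Finset.univ.val.map y)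
    (by simpa using hy) (by simp) hprod
  rw [← h]
  refine Finset.sum_congr rfl fun i _ => ?_
  congr 1
  · rw [Multiset.map_map]
    rfl
  · rw [← Finset.mul_prod_erase Finset.univ _ (Finset.mem_univ i), if_pos rfl, one_mul]
    exact Finset.prod_congr rfl fun j hj => if_neg (Finset.ne_of_mem_erase hj)

/-! ### Theta shifted factorials of integer order -/

@[simp] lemma thetaFactorial_zero (q p a : ℂ) : thetaFactorial q p a 0 = 1 := by
  change ∏ k ∈ Finset.range 0, _ = _
  simp

lemma thetaFactorial_add_one {q p a : ℂ} (h : ∀ m : ℤ, theta p (a * q ^ m) ≠ 0) (n : ℤ) :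
    thetaFactorial q p a (n + 1) = thetaFactorial q p a n * theta p (a * q ^ n) := by
  match n with
  | Int.ofNat n => exact Finset.prod_range_succ _ _
  | Int.negSucc 0 =>
    have h1 : thetaFactorial q p a (Int.negSucc 0) = 1 / theta p (a * q ^ Int.negSucc 0) := by
      simp [thetaFactorial]
    rw [h1, one_div, inv_mul_cancel₀ (h _)]
    exact thetaFactorial_zero q p a
  | Int.negSucc (m + 1) =>
    change 1 / ∏ k ∈ Finset.range (m + 1), _ = 1 / (∏ k ∈ Finset.range (m + 1 + 1), _) * _
    rw [Finset.prod_range_succ' _ (m + 1), mul_comm, one_div, one_div, mul_inv, mul_comm, mul_assoc,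
      Int.negSucc_eq]
    have := h (-((m + 1 : ℕ) + 1))
    simp only [Nat.cast_zero, add_zero]
    rw [inv_mul_cancel₀ this, mul_one]
    congr 1
    refine Finset.prod_congr rfl fun k _ => ?_
    push_cast
    ring_nf

lemma thetaFactorial_ne_zero {q p a : ℂ} (h : ∀ m : ℤ, theta p (a * q ^ m) ≠ 0) (n : ℤ) :
    thetaFactorial q p a n ≠ 0 := by
  match n with
  | Int.ofNat n => exact Finset.prod_ne_zero_iff.mpr fun k _ => h k
  | Int.negSucc m => exact one_div_ne_zero (Finset.prod_ne_zero_iff.mpr fun k _ => h _)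

lemma eq_of_int_recurrence {u v c : ℤ → ℂ} (hc : ∀ n, c n ≠ 0) (hu : ∀ n, u (n + 1) = u n * c n)
    (hv : ∀ n, v (n + 1) = v n * c n) (h0 : u 0 = v 0) (n : ℤ) : u n = v n := by
  induction n using Int.induction_on with
  | zero => exact h0
  | succ n ih => rw [hu, hv, ih]
  | pred n ih =>
    have h1 := hu (-n - 1)
    have h2 := hv (-n - 1)
    rw [sub_add_cancel] at h1 h2
    exact mul_right_cancel₀ (hc _) (h1.symm.trans (ih.trans h2))

lemma thetaFactorial_mul_zpow {q p a : ℂ} (hq : q ≠ 0) (h : ∀ m : ℤ, theta p (a * q ^ m) ≠ 0)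
    (c n : ℤ) : thetaFactorial q p (a * q ^ c) n =
      thetaFactorial q p a (c + n) / thetaFactorial q p a c := by
  have e : ∀ m : ℤ, a * q ^ c * q ^ m = a * q ^ (c + m) := fun m => by
    rw [zpow_add₀ hq, mul_assoc]
  refine eq_of_int_recurrence (v := fun n => thetaFactorial q p a (c + n) / thetaFactorial q p a c)
    (c := fun n => theta p (a * q ^ (c + n))) (fun n => h _) (fun n => ?_)
    (fun n => ?_) ?_ n
  · rw [thetaFactorial_add_one fun m => by rw [e]; exact h _, e]
  · rw [← add_assoc, thetaFactorial_add_one h, div_mul_eq_mul_div]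
  · rw [thetaFactorial_zero, add_zero, div_self (thetaFactorial_ne_zero h c)]

lemma thetaFactorial_base_add_one (q p : ℂ) (n : ℕ) :
    thetaFactorial q p q ((n : ℤ) + 1) = thetaFactorial q p q n * theta p (q ^ (n + 1)) := by
  refine (Finset.prod_range_succ _ _).trans ?_
  congr 2
  rw [zpow_natCast, pow_succ']

/-- The convention `1 / (q; q, p)_n = 0` for `n < 0`: the value `(q; q, p)_n` itself is `0` in the
junk-value sense, because its denominator contains the factor `θ(1) = 0`. -/
lemma thetaFactorial_base_of_neg {q p : ℂ} (hq : q ≠ 0) (hp : ‖p‖ < 1) {n : ℤ} (hn : n < 0) :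
    thetaFactorial q p q n = 0 := by
  obtain ⟨m, rfl⟩ : ∃ m : ℕ, n = Int.negSucc m := ⟨(-n - 1).toNat, by omega⟩
  change 1 / ∏ k ∈ Finset.range (m + 1), _ = _
  rw [Finset.prod_eq_zero (i := m) (by simp), div_zero]
  rw [neg_add_rev, neg_add_cancel_right, zpow_neg_one, mul_inv_cancel₀ hq, theta_one hp]

lemma thetaFactorial_base_ne_zero {q p : ℂ} {N n : ℕ} (hn : n ≤ N)
    (h : ∀ m : ℕ, 1 ≤ m → m ≤ N → theta p (q ^ m) ≠ 0) : thetaFactorial q p q n ≠ 0 := by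
  refine Finset.prod_ne_zero_iff.mpr fun k hk => ?_
  have := Finset.mem_range.mp hk
  rw [zpow_natCast, ← pow_succ']
  exact h _ (by omega) (by omega)

/-- A product of integer length telescopes. -/
lemma prodOneTo_eq_div {f X : ℤ → ℂ} (hX : ∀ n, X n ≠ 0) (h : ∀ n, X n = X (n - 1) * f n) (n : ℤ) :
    prodOneTo f n = X n / X 0 := by
  have key : ∀ m : ℕ, ∀ c : ℤ, X (c + m) = X c * ∏ j ∈ Finset.range m, f (c + ((j : ℤ) + 1)) := by
    intro m c
    induction m with
    | zero => simp
    | succ m ih =>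
      rw [Finset.prod_range_succ, ← mul_assoc, ← ih, h]
      push_cast
      rw [← add_assoc, add_sub_cancel_right]
  match n with
  | Int.ofNat n =>
    have := key n 0
    simp only [zero_add] at this
    rw [Int.ofNat_eq_natCast, this, mul_div_cancel_left₀ _ (hX 0)]
    rfl
  | Int.negSucc m =>
    have h1 := key (m + 1) (Int.negSucc m)
    have h2 : Int.negSucc m + (m + 1 : ℕ) = 0 := by rw [Int.negSucc_eq]; push_cast; ring
    rw [h2, ← Finset.prod_range_reflect] at h1
    have h3 : ∏ j ∈ Finset.range (m + 1), f (Int.negSucc m + (((m + 1 - 1 - j : ℕ) : ℤ) + 1)) =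
        ∏ j ∈ Finset.range (m + 1), f (-(j : ℤ)) := by
      refine Finset.prod_congr rfl fun j hj => ?_
      have := Finset.mem_range.mp hj
      congr 1
      omega
    rw [h3] at h1
    rw [h1]
    have h4 := hX (Int.negSucc m)
    rw [div_mul_cancel_left₀ h4, ← one_div]
    rfl

/-! ### Evaluation of the weights -/

/-- The product of theta functions to which the factors of `bigWeight` in the variable
`x = a / b` telescope. -/
noncomputable def pairFactorial (q p x : ℂ) (n : ℤ) : ℂ :=
  thetaFactorial q p x n * thetaFactorial q p x (n + 1)

lemma pairFactorial_ne_zero {q p x : ℂ} (h : ∀ m : ℤ, theta p (x * q ^ m) ≠ 0) (n : ℤ) :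
    pairFactorial q p x n ≠ 0 :=
  mul_ne_zero (thetaFactorial_ne_zero h _) (thetaFactorial_ne_zero h _)

lemma shiftedBigWeight_eq {q p a b : ℂ} (hq : q ≠ 0) (ha : ∀ m : ℤ, theta p (a * q ^ m) ≠ 0)
    (hb : ∀ m : ℤ, theta p (b * q ^ m) ≠ 0) (hab : ∀ m : ℤ, theta p (a / b * q ^ m) ≠ 0)
    (ρ s t : ℤ) : shiftedBigWeight q p a b ρ s t =
      q ^ t * (theta p (a * q ^ (2 * ρ + s + 2 * t)) / theta p (a * q ^ (2 * ρ + s))) *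
      (theta p (b * q ^ (2 * ρ + 2 * s - 1)) * theta p (b * q ^ (2 * ρ + 2 * s)) /
        (theta p (b * q ^ (2 * ρ + 2 * s + t - 1)) * theta p (b * q ^ (2 * ρ + 2 * s + t)))) *
      (theta p (a / b * q ^ (-s)) * theta p (a / b * q ^ (1 - s)) /
        (theta p (a / b * q ^ (t - s)) * theta p (a / b * q ^ (t - s + 1)))) := by
  set X : ℤ → ℂ := fun j => q ^ j * theta p (a * q ^ (2 * ρ + s + 2 * j)) /
    (theta p (b * q ^ (2 * ρ + 2 * s + j - 1)) * theta p (b * q ^ (2 * ρ + 2 * s + j)) *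
      (theta p (a / b * q ^ (j - s)) * theta p (a / b * q ^ (j - s + 1)))) with hX
  have hX0 : ∀ j, X j ≠ 0 := fun j => div_ne_zero (mul_ne_zero (zpow_ne_zero _ hq) (ha _))
    (mul_ne_zero (mul_ne_zero (hb _) (hb _)) (mul_ne_zero (hab _) (hab _)))
  rw [shiftedBigWeight, bigWeight, prodOneTo_eq_div hX0]
  · simp only [hX, mul_zero, add_zero, zpow_zero, zero_sub, one_mul]
    rw [show -s + 1 = 1 - s by ring]
    have := ha (2 * ρ + s)
    field_simp
  · intro j
    have e1 : ∀ c m : ℤ, a * q ^ c * q ^ m = a * q ^ (c + m) := fun c m => by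
      rw [zpow_add₀ hq, mul_assoc]
    have e2 : ∀ c m : ℤ, b * q ^ c * q ^ m = b * q ^ (c + m) := fun c m => by
      rw [zpow_add₀ hq, mul_assoc]
    have e3 : ∀ c m : ℤ, a * q ^ c * q ^ m / (b * q ^ c) = a / b * q ^ m := fun c m => by
      have := zpow_ne_zero c hq
      field_simp
    simp only [smallWeight, e3]
    simp only [hX, e1, e2]
    rw [show 2 * ρ + (s + 2 * j) = 2 * ρ + s + 2 * j by ring,
      show 2 * ρ + (2 * s + j - 2) = 2 * ρ + 2 * s + (j - 1) - 1 by ring,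
      show 2 * ρ + (s + 2 * j - 2) = 2 * ρ + s + 2 * (j - 1) by ring,
      show 2 * ρ + (2 * s + j) = 2 * ρ + 2 * s + j by ring,
      show j - s - 1 = j - 1 - s by ring, show j - 1 - s + 1 = j - s by ring,
      show 2 * ρ + 2 * s + (j - 1) = 2 * ρ + 2 * s + j - 1 by ring]
    have h1 := ha (2 * ρ + s + 2 * (j - 1))
    have h2 := hb (2 * ρ + 2 * s + j - 1 - 1)
    have h3 := hb (2 * ρ + 2 * s + j - 1)
    have h4 := hb (2 * ρ + 2 * s + j)
    have h5 := hab (j - 1 - s)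
    have h6 := hab (j - s)
    have h7 := hab (j - s + 1)
    generalize theta p (a * q ^ (2 * ρ + s + 2 * (j - 1))) = x1 at h1 ⊢
    generalize theta p (b * q ^ (2 * ρ + 2 * s + j - 1 - 1)) = x2 at h2 ⊢
    generalize theta p (b * q ^ (2 * ρ + 2 * s + j - 1)) = x3 at h3 ⊢
    generalize theta p (b * q ^ (2 * ρ + 2 * s + j)) = x4 at h4 ⊢
    generalize theta p (a / b * q ^ (j - 1 - s)) = x5 at h5 ⊢
    generalize theta p (a / b * q ^ (j - s)) = x6 at h6 ⊢
    generalize theta p (a / b * q ^ (j - s + 1)) = x7 at h7 ⊢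
    rw [zpow_sub_one₀ hq]
    field_simp

lemma bigQWeight_eq {q p a b : ℂ} (hq : q ≠ 0) (ha : ∀ m : ℤ, theta p (a * q ^ m) ≠ 0)
    (hb : ∀ m : ℤ, theta p (b * q ^ m) ≠ 0) (hab : ∀ m : ℤ, theta p (a / b * q ^ m) ≠ 0)
    (l ρ s t : ℤ) : bigQWeight q p a b l ρ s t =
      (thetaFactorial q p a (2 * (ρ + t) + (s + l) + 1) /
          thetaFactorial q p a (2 * (ρ + t) + s + 1) /
        (thetaFactorial q p a (2 * ρ + (s + l) + 1) / thetaFactorial q p a (2 * ρ + s + 1))) *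
      (thetaFactorial q p b (2 * (ρ + s + l) + 1) / thetaFactorial q p b (2 * (ρ + s + l) + t + 1) /
        (thetaFactorial q p b (2 * (ρ + s) + 1) / thetaFactorial q p b (2 * (ρ + s) + t + 1))) *
      (q ^ (t * l) * (pairFactorial q p (a / b) (-s) * pairFactorial q p (a / b) (t - (s + l)) /
        (pairFactorial q p (a / b) (-(s + l)) * pairFactorial q p (a / b) (t - s)))) := by
  set A := thetaFactorial q p a
  set B := thetaFactorial q p b
  set G := thetaFactorial q p (a / b) with hG
  have hA0 : ∀ n, A n ≠ 0 := thetaFactorial_ne_zero ha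
  have hB0 : ∀ n, B n ≠ 0 := thetaFactorial_ne_zero hb
  have hG0 : ∀ n, G n ≠ 0 := thetaFactorial_ne_zero hab
  have hA : ∀ n, A (n + 1) = A n * theta p (a * q ^ n) := thetaFactorial_add_one ha
  have hB : ∀ n, B (n + 1) = B n * theta p (b * q ^ n) := thetaFactorial_add_one hb
  have hGs : ∀ n, G (n + 1) = G n * theta p (a / b * q ^ n) := thetaFactorial_add_one hab
  set X : ℤ → ℂ := fun i => q ^ (t * i) * (A (2 * ρ + s + 2 * t + i + 1) / A (2 * ρ + s + i + 1)) *
    (B (2 * ρ + 2 * s + 2 * i + 1) / B (2 * ρ + 2 * s + 2 * i + t + 1)) *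
    (G (t - s - i) * G (t - s - i + 1) / (G (-s - i) * G (-s - i + 1))) with hX
  have hX0 : ∀ i, X i ≠ 0 := fun i => mul_ne_zero (mul_ne_zero (mul_ne_zero (zpow_ne_zero _ hq)
    (div_ne_zero (hA0 _) (hA0 _))) (div_ne_zero (hB0 _) (hB0 _)))
    (div_ne_zero (mul_ne_zero (hG0 _) (hG0 _)) (mul_ne_zero (hG0 _) (hG0 _)))
  rw [bigQWeight, prodOneTo_eq_div hX0]
  · simp only [hX, pairFactorial, ← hG, mul_zero, add_zero, sub_zero, zpow_zero, one_mul]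
    rw [show 2 * (ρ + t) + (s + l) + 1 = 2 * ρ + s + 2 * t + l + 1 by ring,
      show 2 * (ρ + t) + s + 1 = 2 * ρ + s + 2 * t + 1 by ring,
      show 2 * ρ + (s + l) + 1 = 2 * ρ + s + l + 1 by ring,
      show 2 * (ρ + s + l) + 1 = 2 * ρ + 2 * s + 2 * l + 1 by ring,
      show 2 * (ρ + s + l) + t + 1 = 2 * ρ + 2 * s + 2 * l + t + 1 by ring,
      show 2 * (ρ + s) + 1 = 2 * ρ + 2 * s + 1 by ring,
      show 2 * (ρ + s) + t + 1 = 2 * ρ + 2 * s + t + 1 by ring,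
      show t - (s + l) = t - s - l by ring, show -(s + l) = -s - l by ring]
    simp only [div_eq_mul_inv, mul_inv, inv_inv]
    ring
  · intro i
    rw [shiftedBigWeight_eq hq ha hb hab]
    simp only [hX]
    have a1 := hA (2 * ρ + s + 2 * t + i)
    have a2 := hA (2 * ρ + s + i)
    have b1 := hB (2 * ρ + 2 * s + 2 * i)
    have b2 := hB (2 * ρ + 2 * s + 2 * i - 1)
    have b3 := hB (2 * ρ + 2 * s + 2 * i + t)
    have b4 := hB (2 * ρ + 2 * s + 2 * i + t - 1)
    have g1 := hGs (t - s - i + 1)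
    have g2 := hGs (t - s - i)
    have g3 := hGs (-s - i + 1)
    have g4 := hGs (-s - i)
    rw [sub_add_cancel] at b2 b4
    rw [show 2 * ρ + s + 2 * t + (i - 1) + 1 = 2 * ρ + s + 2 * t + i by ring,
      show 2 * ρ + s + (i - 1) + 1 = 2 * ρ + s + i by ring,
      show 2 * ρ + 2 * s + 2 * (i - 1) + 1 = 2 * ρ + 2 * s + 2 * i - 1 by ring,
      show 2 * ρ + 2 * s + 2 * (i - 1) + t + 1 = 2 * ρ + 2 * s + 2 * i + t - 1 by ring,
      show t - s - (i - 1) = t - s - i + 1 by ring, show -s - (i - 1) = -s - i + 1 by ring,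
      show t * i = t * (i - 1) + t by ring, zpow_add₀ hq, a1, a2, b1, b2, b3, b4, g1, g2, g3, g4,
      show 2 * ρ + (i + s) + 2 * t = 2 * ρ + s + 2 * t + i by ring,
      show 2 * ρ + (i + s) = 2 * ρ + s + i by ring,
      show 2 * ρ + 2 * (i + s) = 2 * ρ + 2 * s + 2 * i by ring,
      show t - (i + s) = t - s - i by ring, show -(i + s) = -s - i by ring,
      show 1 - (i + s) = -s - i + 1 by ring]
    have h1 := ha (2 * ρ + s + i)
    have h2 := hb (2 * ρ + 2 * s + 2 * i + t)
    have h3 := hb (2 * ρ + 2 * s + 2 * i + t - 1)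
    have h4 := hab (t - s - i + 1)
    have h5 := hab (t - s - i)
    have h6 := hab (-s - i + 1)
    have h7 := hab (-s - i)
    generalize theta p (a * q ^ (2 * ρ + s + i)) = x1 at h1 ⊢
    generalize theta p (b * q ^ (2 * ρ + 2 * s + 2 * i + t)) = x2 at h2 ⊢
    generalize theta p (b * q ^ (2 * ρ + 2 * s + 2 * i + t - 1)) = x3 at h3 ⊢
    generalize theta p (a / b * q ^ (t - s - i + 1)) = x4 at h4 ⊢
    generalize theta p (a / b * q ^ (t - s - i)) = x5 at h5 ⊢
    generalize theta p (a / b * q ^ (-s - i + 1)) = x6 at h6 ⊢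
    generalize theta p (a / b * q ^ (-s - i)) = x7 at h7 ⊢
    have := hA0 (2 * ρ + s + 2 * t + i)
    have := hA0 (2 * ρ + s + i)
    have := hB0 (2 * ρ + 2 * s + 2 * i - 1)
    have := hB0 (2 * ρ + 2 * s + 2 * i + t - 1)
    have := hG0 (t - s - i)
    have := hG0 (-s - i)
    field_simp

/-- A product over a finite set of integers along partial sums telescopes. -/
lemma prod_div_partial_sums {ι : Type*} [LinearOrder ι] (S : Finset ι) (k : ι → ℤ) (g : ℤ → ℂ)
    (hg : ∀ m, g m ≠ 0) (c : ℤ) :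
    ∏ j ∈ S, g (c + ∑ ν ∈ S with ν < j, k ν + k j) / g (c + ∑ ν ∈ S with ν < j, k ν) =
      g (c + ∑ ν ∈ S, k ν) / g c := by
  induction S using Finset.induction_on_max with
  | empty => simp [div_self (hg c)]
  | insert m S hm ih =>
    have hmS : m ∉ S := fun h => lt_irrefl m (hm m h)
    have e1 : (insert m S).filter (fun ν => ν < m) = S := by
      ext ν
      simp only [Finset.mem_filter, Finset.mem_insert]
      exact ⟨fun h => h.1.resolve_left h.2.ne, fun h => ⟨Or.inr h, hm ν h⟩⟩
    have e2 : ∀ j ∈ S, (insert m S).filter (fun ν => ν < j) = S.filter fun ν => ν < j := by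
      intro j hj
      rw [Finset.filter_insert, if_neg (hm j hj).not_gt]
    rw [Finset.prod_insert hmS, Finset.sum_insert hmS, e1,
      Finset.prod_congr rfl fun j hj => by rw [e2 j hj], ih]
    rw [add_comm (k m), ← add_assoc]
    have := hg (c + ∑ ν ∈ S, k ν)
    field_simp

/-! ### Splitting the multinomial coefficients and the weights -/

variable {r : ℕ}

/-- The genericity assumption on the variables `a_1, …, a_r`. -/
structure Generic (q p : ℂ) (a : Fin r → ℂ) : Prop where
  ne_zero : ∀ i, a i ≠ 0
  theta_ne_zero : ∀ i (m : ℤ), theta p (a i * q ^ m) ≠ 0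
  theta_div_ne_zero : ∀ i j (m : ℤ), i < j → theta p (a i / a j * q ^ m) ≠ 0

/-- The variables `a_i q ^ (c - k_i)` that occur after the steps `k_1, …, k_r` have been taken. -/
noncomputable def shiftBase (q : ℂ) (a : Fin r → ℂ) (c : ℤ) (k : Fin r → ℤ) : Fin r → ℂ :=
  fun i => a i * q ^ (c - k i)

lemma shiftBase_div {q : ℂ} (hq : q ≠ 0) (a : Fin r → ℂ) (c : ℤ) (k : Fin r → ℤ) (i j : Fin r) :
    shiftBase q a c k i / shiftBase q a c k j = a i / a j * q ^ (k j - k i) := by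
  have h1 := zpow_ne_zero (k j) hq
  have h2 := zpow_ne_zero (k i) hq
  have h3 := zpow_ne_zero c hq
  rw [shiftBase, shiftBase, zpow_sub₀ hq, zpow_sub₀ hq, zpow_sub₀ hq]
  field_simp

lemma Generic.shiftBase {q p : ℂ} {a : Fin r → ℂ} (hq : q ≠ 0) (h : Generic q p a) (c : ℤ)
    (k : Fin r → ℤ) : Generic q p (shiftBase q a c k) where
  ne_zero i := mul_ne_zero (h.ne_zero i) (zpow_ne_zero _ hq)
  theta_ne_zero i m := by
    rw [EllMult.shiftBase, mul_assoc, ← zpow_add₀ hq]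
    exact h.theta_ne_zero i _
  theta_div_ne_zero i j m hij := by
    rw [shiftBase_div hq, mul_assoc, ← zpow_add₀ hq]
    exact h.theta_div_ne_zero i j _ hij

lemma shiftBase_shiftBase {q : ℂ} (hq : q ≠ 0) (a : Fin r → ℂ) (c d : ℤ) (e k : Fin r → ℤ) :
    shiftBase q (shiftBase q a c e) d (k - e) = shiftBase q a (c + d) k := by
  funext i
  rw [shiftBase, shiftBase, shiftBase, mul_assoc, ← zpow_add₀ hq, Pi.sub_apply]
  ring_nf

/-- The elliptic multinomial coefficient without the factors `(a_i q^{1 + 2 K_{i-1}}; q, p)_{k_i}`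
in its denominator. -/
noncomputable def multNumer (q p : ℂ) (a : Fin r → ℂ) (k : Fin r → ℤ) : ℂ :=
  thetaFactorial q p q (∑ i, k i) / (∏ i, thetaFactorial q p q (k i)) *
    (∏ i, thetaFactorial q p (a i * q ^ (1 + (∑ ν, k ν) - k i)) (k i)) *
    ∏ i, ∏ j ∈ Finset.univ.filter (fun j => i < j),
      thetaFactorial q p (a i * q ^ (1 - k i) / a j) (k j) /
        thetaFactorial q p (a i * q / a j) (k j)

/-- The denominator factors `∏_i (a_i q^{1 + 2 K_{i-1}}; q, p)_{k_i}`. -/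
noncomputable def multDenom (q p : ℂ) (a : Fin r → ℂ) (k : Fin r → ℤ) : ℂ :=
  ∏ i, thetaFactorial q p (a i * q ^ (1 + 2 * sumBefore k i)) (k i)

lemma ellMultinomial_eq_div (q p : ℂ) (a : Fin r → ℂ) (k : Fin r → ℤ) :
    ellMultinomial q p a k = multNumer q p a k / multDenom q p a k := by
  rw [ellMultinomial, multNumer, multDenom, Finset.prod_div_distrib]
  ring

/-- The part of the `Q`-weight that depends only on `a_i / a_j`. -/
noncomputable def pairWeight (q p : ℂ) (a : Fin r → ℂ) (n k : Fin r → ℤ) (i j : Fin r) : ℂ :=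
  q ^ (k j * (n i - k i)) *
    (pairFactorial q p (a i / a j) (-k i) * pairFactorial q p (a i / a j) (k j - n i) /
      (pairFactorial q p (a i / a j) (-n i) * pairFactorial q p (a i / a j) (k j - k i)))

/-- The product of the parts of the `Q`-weights that depend only on the quotients `a_i / a_j`. -/
noncomputable def crossWeight (q p : ℂ) (a : Fin r → ℂ) (n k : Fin r → ℤ) : ℂ :=
  ∏ i, ∏ j ∈ Finset.univ.filter (fun j => i < j), pairWeight q p a n k i j

lemma multDenom_ne_zero {q p : ℂ} (hq : q ≠ 0) {a : Fin r → ℂ} (h : Generic q p a)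
    (k : Fin r → ℤ) : multDenom q p a k ≠ 0 := by
  refine Finset.prod_ne_zero_iff.mpr fun i _ => thetaFactorial_ne_zero (fun m => ?_) _
  rw [mul_assoc, ← zpow_add₀ hq]
  exact h.theta_ne_zero i _

lemma multDenom_eq {q p : ℂ} (hq : q ≠ 0) {a : Fin r → ℂ} (h : Generic q p a) (k : Fin r → ℤ) :
    multDenom q p a k = ∏ i, thetaFactorial q p (a i) (1 + 2 * sumBefore k i + k i) /
      thetaFactorial q p (a i) (1 + 2 * sumBefore k i) :=
  Finset.prod_congr rfl fun i _ => thetaFactorial_mul_zpow hq (h.theta_ne_zero i) _ _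

lemma multDenom_shiftBase_eq {q p : ℂ} (hq : q ≠ 0) {a : Fin r → ℂ} (h : Generic q p a) (c : ℤ)
    (n k : Fin r → ℤ) : multDenom q p (shiftBase q a c k) n =
      ∏ i, thetaFactorial q p (a i) (c - k i + 1 + 2 * sumBefore n i + n i) /
        thetaFactorial q p (a i) (c - k i + 1 + 2 * sumBefore n i) := by
  refine Finset.prod_congr rfl fun i _ => ?_
  rw [shiftBase, mul_assoc, ← zpow_add₀ hq, thetaFactorial_mul_zpow hq (h.theta_ne_zero i),
    ← add_assoc]

lemma sumUpTo_eq (k : Fin r → ℤ) (i : Fin r) : sumUpTo k i = sumBefore k i + k i := by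
  have : Finset.univ.filter (fun ν => ν ≤ i) = insert i (Finset.univ.filter fun ν => ν < i) := by
    ext ν
    simp [le_iff_eq_or_lt]
  rw [sumUpTo, sumBefore, this, Finset.sum_insert (by simp), add_comm]

lemma sumUpTo_add_sum_gt (k : Fin r → ℤ) (i : Fin r) :
    sumUpTo k i + ∑ ν with i < ν, k ν = ∑ ν, k ν := by
  rw [sumUpTo, ← Finset.sum_filter_add_sum_filter_not Finset.univ (fun ν => ν ≤ i)]
  simp only [not_le]

lemma sumBefore_sub (n k : Fin r → ℤ) (i : Fin r) :
    sumBefore (n - k) i = sumBefore n i - sumBefore k i :=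
  Finset.sum_sub_distrib _ _

lemma sumBefore_eq_of_lt (k : Fin r → ℤ) {i j : Fin r} (hij : i < j) :
    sumBefore k j = sumUpTo k i + ∑ ν ∈ Finset.univ.filter (fun ν => i < ν) with ν < j, k ν := by
  rw [sumUpTo, sumBefore, ← Finset.sum_filter_add_sum_filter_not _ (fun ν => ν ≤ i)]
  congr 2
  · ext ν
    simp only [Finset.mem_filter, Finset.mem_univ, true_and]
    exact ⟨fun h => h.2, fun h => ⟨h.trans_lt hij, h⟩⟩
  · ext ν
    simp only [Finset.mem_filter, Finset.mem_univ, true_and, not_le]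
    exact and_comm

lemma sumBefore_eq_sum_filter (k : Fin r → ℤ) {i j : Fin r} (hij : i < j) :
    sumBefore k i = ∑ ν ∈ Finset.univ.filter (fun ν => ν < j) with ν < i, k ν := by
  rw [sumBefore, Finset.filter_filter]
  congr 1
  ext ν
  simp only [Finset.mem_filter, Finset.mem_univ, true_and]
  exact ⟨fun h => ⟨h.trans hij, h⟩, fun h => h.2⟩

lemma prod_prod_gt_comm (f : Fin r → Fin r → ℂ) :
    ∏ i, ∏ j ∈ Finset.univ.filter (fun j => i < j), f i j =
      ∏ j, ∏ i ∈ Finset.univ.filter (fun i => i < j), f i j :=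
  Finset.prod_comm' fun _ _ => by simp

/-- In the product of all `Q`-weights the factors that contain a single variable telescope, and
what remains of them is a coboundary of `multDenom`. -/
lemma prod_bigQWeight_eq {q p : ℂ} (hq : q ≠ 0) {a : Fin r → ℂ} (h : Generic q p a)
    (n k : Fin r → ℤ) :
    ∏ i, ∏ j ∈ Finset.univ.filter (fun j => i < j), bigQWeight q p (a i) (a j) (n i - k i)
        (sumBefore n i + sumBefore k j - sumUpTo k i) (k i) (k j) =
      multDenom q p (shiftBase q a (2 * ∑ i, k i) k) (n - k) * multDenom q p a k /
        multDenom q p a n * crossWeight q p a n k := by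
  set F : Fin r → ℤ → ℂ := fun i => thetaFactorial q p (a i) with hF
  have hF0 : ∀ i m, F i m ≠ 0 := fun i m => thetaFactorial_ne_zero (h.theta_ne_zero i) m
  set g : Fin r → ℤ → ℂ := fun i m => F i (2 * m + n i + 1) / F i (2 * m + k i + 1) with hg
  set f : Fin r → ℤ → ℂ := fun j m => F j (2 * m + 1) / F j (2 * m + k j + 1) with hf
  have step : ∀ i, ∀ j ∈ Finset.univ.filter (fun j => i < j),
      bigQWeight q p (a i) (a j) (n i - k i)
        (sumBefore n i + sumBefore k j - sumUpTo k i) (k i) (k j) =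
      (g i (sumBefore n i +
          ∑ ν ∈ Finset.univ.filter (fun ν => i < ν) with ν < j, k ν + k j) /
        g i (sumBefore n i + ∑ ν ∈ Finset.univ.filter (fun ν => i < ν) with ν < j, k ν)) *
      (f j (sumBefore k j +
          ∑ ν ∈ Finset.univ.filter (fun ν => ν < j) with ν < i, (n - k) ν + (n - k) i) /
        f j (sumBefore k j + ∑ ν ∈ Finset.univ.filter (fun ν => ν < j) with ν < i, (n - k) ν)) *
      pairWeight q p a n k i j := by
    intro i j hij
    have hij := (Finset.mem_filter.mp hij).2
    rw [bigQWeight_eq hq (h.theta_ne_zero i) (h.theta_ne_zero j)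
      (fun m => h.theta_div_ne_zero i j m hij), pairWeight, ← sumBefore_eq_sum_filter _ hij,
      sumBefore_sub, sumBefore_eq_of_lt k hij, sumUpTo_eq, Pi.sub_apply]
    simp only [hg, hf, hF]
    ring_nf
  rw [Finset.prod_congr rfl fun i _ => Finset.prod_congr rfl (step i)]
  simp only [Finset.prod_mul_distrib]
  rw [prod_prod_gt_comm fun i j => f j _ / f j _]
  have hg0 : ∀ i m, g i m ≠ 0 := fun i m => div_ne_zero (hF0 _ _) (hF0 _ _)
  have hf0 : ∀ i m, f i m ≠ 0 := fun i m => div_ne_zero (hF0 _ _) (hF0 _ _)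
  rw [Finset.prod_congr rfl fun i _ => prod_div_partial_sums _ k (g i) (hg0 i) (sumBefore n i),
    Finset.prod_congr rfl fun j _ =>
      prod_div_partial_sums _ (n - k) (f j) (hf0 j) (sumBefore k j), crossWeight]
  congr 1
  rw [multDenom_shiftBase_eq hq h, multDenom_eq hq h, multDenom_eq hq h, ← Finset.prod_mul_distrib,
    ← Finset.prod_mul_distrib, ← Finset.prod_div_distrib]
  refine Finset.prod_congr rfl fun i _ => ?_
  have e1 : ∑ ν with ν < i, (n - k) ν = sumBefore n i - sumBefore k i := sumBefore_sub n k i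
  have e2 := sumUpTo_add_sum_gt k i
  rw [sumUpTo_eq] at e2
  rw [e1, ← e2, sumBefore_sub, Pi.sub_apply]
  have hFi : ∀ m, thetaFactorial q p (a i) m = F i m := fun _ => rfl
  simp only [hg, hf, hFi]
  set s := ∑ ν with i < ν, k ν
  have d1 := hF0 i (2 * (sumBefore n i + s) + k i + 1)
  have d2 := hF0 i (2 * sumBefore n i + k i + 1)
  have d3 := hF0 i (2 * sumBefore n i + n i + 1)
  have d4 := hF0 i (2 * sumBefore k i + 1)
  have d5 := hF0 i (2 * sumBefore n i + 1)
  rw [show sumBefore k i + (sumBefore n i - sumBefore k i) = sumBefore n i by ring,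
    show 2 * (sumBefore k i + k i + s) - k i + 1 + 2 * (sumBefore n i - sumBefore k i) +
      (n i - k i) = 2 * (sumBefore n i + s) + n i + 1 by ring,
    show 2 * (sumBefore k i + k i + s) - k i + 1 + 2 * (sumBefore n i - sumBefore k i) =
      2 * (sumBefore n i + s) + k i + 1 by ring,
    show 1 + 2 * sumBefore k i + k i = 2 * sumBefore k i + k i + 1 by ring,
    show 1 + 2 * sumBefore n i + n i = 2 * sumBefore n i + n i + 1 by ring,
    show 1 + 2 * sumBefore k i = 2 * sumBefore k i + 1 by ring,
    show 1 + 2 * sumBefore n i = 2 * sumBefore n i + 1 by ring]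
  have d6 := hF0 i (2 * sumBefore k i + k i + 1)
  field_simp

/-- The cocycle relation of the cross weights: taking the steps `e` and then `k - e` out of `n`
amounts to taking `e` out of `k` and then `k` out of `n`. -/
lemma crossWeight_cocycle {q p : ℂ} (hq : q ≠ 0) {a : Fin r → ℂ} (h : Generic q p a) (c : ℤ)
    (n k e : Fin r → ℤ) :
    crossWeight q p a n e * crossWeight q p (shiftBase q a c e) (n - e) (k - e) =
      crossWeight q p a k e * crossWeight q p a n k := by
  simp only [crossWeight, ← Finset.prod_mul_distrib]
  refine Finset.prod_congr rfl fun i _ => Finset.prod_congr rfl fun j hj => ?_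
  have hG : ∀ m : ℤ, theta p (a i / a j * q ^ m) ≠ 0 := fun m =>
    h.theta_div_ne_zero i j m (Finset.mem_filter.mp hj).2
  have hF : ∀ m, pairFactorial q p (shiftBase q a c e i / shiftBase q a c e j) m =
      pairFactorial q p (a i / a j) (m + (e j - e i)) /
        thetaFactorial q p (a i / a j) (e j - e i) ^ 2 := by
    intro m
    rw [shiftBase_div hq, pairFactorial, thetaFactorial_mul_zpow hq hG,
      thetaFactorial_mul_zpow hq hG, pairFactorial, div_mul_div_comm, sq]
    ring_nf
  have hP := pairFactorial_ne_zero hG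
  have hT := thetaFactorial_ne_zero hG (e j - e i)
  simp only [pairWeight, hF, Pi.sub_apply]
  generalize pairFactorial q p (a i / a j) = P at hP ⊢
  generalize thetaFactorial q p (a i / a j) (e j - e i) = T at hT ⊢
  rw [show -(k i - e i) + (e j - e i) = e j - k i by ring,
    show k j - e j - (n i - e i) + (e j - e i) = k j - n i by ring,
    show -(n i - e i) + (e j - e i) = e j - n i by ring,
    show k j - e j - (k i - e i) + (e j - e i) = k j - k i by ring]
  have e1 : q ^ (e j * (n i - e i)) * q ^ ((k j - e j) * (n i - e i - (k i - e i))) =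
      q ^ (e j * (k i - e i)) * q ^ (k j * (n i - k i)) := by
    rw [← zpow_add₀ hq, ← zpow_add₀ hq]
    ring_nf
  have h1 := hP (-n i)
  have h2 := hP (e j - e i)
  have h3 := hP (e j - n i)
  have h4 := hP (k j - k i)
  have h5 := hP (-k i)
  generalize q ^ (e j * (n i - e i)) = Q1 at e1 ⊢
  generalize q ^ ((k j - e j) * (n i - e i - (k i - e i))) = Q2 at e1 ⊢
  generalize q ^ (e j * (k i - e i)) = Q3 at e1 ⊢
  generalize q ^ (k j * (n i - k i)) = Q4 at e1 ⊢
  field_simp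
  linear_combination (P (-e i) * P (e j - k i) * P (k j - n i)) * e1

lemma crossWeight_zero {q p : ℂ} {a : Fin r → ℂ} (h : Generic q p a) (n : Fin r → ℤ) :
    crossWeight q p a n 0 = 1 := by
  refine Finset.prod_eq_one fun i _ => Finset.prod_eq_one fun j hj => ?_
  have hP := pairFactorial_ne_zero fun m => h.theta_div_ne_zero i j m (Finset.mem_filter.mp hj).2
  simp only [pairWeight, Pi.zero_apply, zero_mul, zpow_zero, one_mul, neg_zero, zero_sub, sub_zero]
  rw [mul_comm, div_self (mul_ne_zero (hP _) (hP _))]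

lemma multNumer_zero (q p : ℂ) (a : Fin r → ℂ) : multNumer q p a 0 = 1 := by
  simp [multNumer]

lemma multNumer_eq_zero {q p : ℂ} (hq : q ≠ 0) (hp : ‖p‖ < 1) (a : Fin r → ℂ) {k : Fin r → ℤ}
    {i : Fin r} (hi : k i < 0) : multNumer q p a k = 0 := by
  rw [multNumer, Finset.prod_eq_zero (Finset.mem_univ i) (thetaFactorial_base_of_neg hq hp hi)]
  simp

/-! ### The one-step recurrence -/

lemma prod_zpow_eq_zpow_sum {q : ℂ} (hq : q ≠ 0) {ι : Type*} (s : Finset ι) (f : ι → ℤ) :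
    ∏ i ∈ s, q ^ f i = q ^ ∑ i ∈ s, f i := by
  classical
  induction s using Finset.induction_on with
  | empty => simp
  | insert i s hi ih => rw [Finset.prod_insert hi, Finset.sum_insert hi, ih, zpow_add₀ hq]

lemma theta_inv_div_theta_inv {p : ℂ} (hp : ‖p‖ < 1) {y z : ℂ} (hy : y ≠ 0) (hz : z ≠ 0) :
    theta p y⁻¹ / theta p z⁻¹ = z / y * (theta p y / theta p z) := by
  rw [theta_inv hp hy, theta_inv hp hz]
  field_simp

/-- The instance of the elliptic partial fraction identity that underlies the recurrence: the nodes
are `a_1, …, a_r` and `q ^ (-N - 2)`, the zeros are `a_i q ^ (-n_i)` and `q ^ (-1)`. -/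
lemma sum_theta_recurrence {q p : ℂ} (hq : q ≠ 0) (hp : ‖p‖ < 1) {a : Fin r → ℂ}
    (h : Generic q p a) (N : ℕ) (n : Fin r → ℤ) (hn : ∑ i, n i = N + 1) :
    ∑ m, theta p (a m * q) * theta p (q ^ n m) / theta p (a m * q ^ (N + 2 : ℤ)) *
        ∏ j, (if j = m then 1 else theta p (a m / a j * q ^ n j) / theta p (a m / a j)) =
      theta p (q ^ (N + 1)) *
        ∏ i, theta p (a i * q ^ (N + 2 - n i)) / theta p (a i * q ^ (N + 2 : ℤ)) := by
  have hqz : ∀ m : ℤ, q ^ m ≠ 0 := fun m => zpow_ne_zero m hq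
  have ha := h.ne_zero
  have haa : ∀ i j, i ≠ j → theta p (a i / a j) ≠ 0 := by
    intro i j hij
    rcases lt_or_gt_of_ne hij with hij | hij
    · simpa using h.theta_div_ne_zero i j 0 hij
    · have h1 : theta p (a j / a i) ≠ 0 := by simpa using h.theta_div_ne_zero j i 0 hij
      have h2 := div_ne_zero (ha j) (ha i)
      rw [← inv_div, theta_inv hp h2]
      exact neg_ne_zero.mpr (div_ne_zero h1 h2)
  have haq := h.theta_ne_zero
  set x : Option (Fin r) → ℂ := fun o => o.elim (q ^ (-(N + 2) : ℤ)) a with hx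
  set y : Option (Fin r) → ℂ := fun o => o.elim q⁻¹ (fun i => a i * q ^ (-n i)) with hy
  have e1 : ∀ i, a i / q ^ (-(N + 2) : ℤ) = a i * q ^ (N + 2 : ℤ) := fun i => by
    rw [zpow_neg, div_inv_eq_mul]
  have e2 : ∀ i, q ^ (-(N + 2) : ℤ) / a i = (a i * q ^ (N + 2 : ℤ))⁻¹ := fun i => by
    rw [zpow_neg, mul_inv, div_eq_mul_inv, mul_comm]
  have key := sum_univ_prod_theta_div_eq_zero hp x y (by rintro (_ | i) <;> simp [hx, hqz, ha])
    (by rintro (_ | i) <;> simp [hy, hq, hqz, ha]) (by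
      rintro (_ | i) (_ | j) hij
      · exact absurd rfl hij
      · change theta p (q ^ (-(N + 2) : ℤ) / a j) ≠ 0
        have h2 := mul_ne_zero (ha j) (hqz (N + 2))
        rw [e2, theta_inv hp h2]
        exact neg_ne_zero.mpr (div_ne_zero (haq j _) h2)
      · change theta p (a i / q ^ (-(N + 2) : ℤ)) ≠ 0
        rw [e1]
        exact haq i _
      · exact haa i j fun e => hij (congrArg some e)) (by
      rw [Fintype.prod_option, Fintype.prod_option]
      simp only [hx, hy, Option.elim]
      rw [Finset.prod_mul_distrib, prod_zpow_eq_zpow_sum hq, Finset.sum_neg_distrib, hn,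
        mul_comm (∏ i, a i), ← mul_assoc, ← zpow_neg_one, ← zpow_add₀ hq]
      ring_nf)
  simp only [Fintype.sum_option, Fintype.prod_option, hx, hy, Option.elim, if_true,
    Option.some_inj, reduceCtorEq, if_false, one_mul] at key
  have t0 : theta p (q ^ (-(N + 2) : ℤ) / q⁻¹) *
        (∏ i, theta p (q ^ (-(N + 2) : ℤ) / (a i * q ^ (-n i)))) /
      ∏ i, theta p (q ^ (-(N + 2) : ℤ) / a i) = -(theta p (q ^ (N + 1)) *
        ∏ i, theta p (a i * q ^ (N + 2 - n i)) / theta p (a i * q ^ (N + 2 : ℤ))) := by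
    have f1 : q ^ (-(N + 2) : ℤ) / q⁻¹ = (q ^ (N + 1))⁻¹ := by
      rw [div_inv_eq_mul, ← zpow_add_one₀ hq, ← zpow_natCast, ← zpow_neg]
      congr 1
    have f2 : ∀ i, theta p (q ^ (-(N + 2) : ℤ) / (a i * q ^ (-n i))) /
        theta p (q ^ (-(N + 2) : ℤ) / a i) =
        q ^ n i * (theta p (a i * q ^ (N + 2 - n i)) / theta p (a i * q ^ (N + 2 : ℤ))) := by
      intro i
      have hi := ha i
      have hqi := hqz (n i)
      have hqn := hqz (N + 2)
      rw [e2, show q ^ (-(N + 2) : ℤ) / (a i * q ^ (-n i)) = (a i * q ^ (N + 2 - n i))⁻¹ by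
          rw [zpow_sub₀ hq, zpow_neg, zpow_neg]; field_simp,
        theta_inv_div_theta_inv hp (mul_ne_zero hi (hqz _)) (mul_ne_zero hi (hqz _))]
      congr 1
      rw [zpow_sub₀ hq]
      field_simp
    rw [mul_div_assoc, ← Finset.prod_div_distrib, Finset.prod_congr rfl fun i _ => f2 i,
      Finset.prod_mul_distrib, prod_zpow_eq_zpow_sum hq, hn, f1, theta_inv hp (pow_ne_zero _ hq),
      show q ^ (N + 1 : ℤ) = q ^ (N + 1) from zpow_natCast q (N + 1)]
    have := pow_ne_zero (N + 1) hq
    generalize ∏ i, theta p (a i * q ^ (N + 2 - n i)) / theta p (a i * q ^ (N + 2 : ℤ)) = P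
    field_simp
  rw [t0, neg_add_eq_zero] at key
  rw [key]
  refine Finset.sum_congr rfl fun m _ => ?_
  have g1 : ∏ j, theta p (a m / (a j * q ^ (-n j))) = theta p (q ^ n m) *
      ∏ j, (if j = m then 1 else theta p (a m / a j * q ^ n j)) := by
    rw [← Finset.mul_prod_erase Finset.univ _ (Finset.mem_univ m),
      ← Finset.mul_prod_erase Finset.univ (fun j => ite _ _ _) (Finset.mem_univ m), if_pos rfl,
      one_mul]
    have g : ∀ j, a m / (a j * q ^ (-n j)) = a m / a j * q ^ n j := fun j => by
      rw [zpow_neg, ← div_div, div_inv_eq_mul]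
    congr 1
    · rw [g, div_self (ha m), one_mul]
    · refine Finset.prod_congr rfl fun j hj => ?_
      rw [if_neg (Finset.ne_of_mem_erase hj), g]
  have g2 : ∀ j, (if j = m then (1 : ℂ) else theta p (a m / a j * q ^ n j) / theta p (a m / a j)) =
      (if j = m then 1 else theta p (a m / a j * q ^ n j)) /
        (if j = m then 1 else theta p (a m / a j)) := by
    intro j
    split_ifs <;> simp
  rw [Finset.prod_congr rfl fun j _ => g2 j, Finset.prod_div_distrib, g1, e1, div_inv_eq_mul,
    mul_div_mul_comm]
  ring

lemma sum_sub_single (n : Fin r → ℤ) (m : Fin r) :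
    ∑ i, (n - Pi.single m 1 : Fin r → ℤ) i = ∑ i, n i - 1 := by
  simp [Finset.sum_sub_distrib]

/-- The factor of `multNumer` belonging to a pair of variables with quotient `x`. -/
lemma multNumer_pair_eq {q p x : ℂ} (hq : q ≠ 0) (h : ∀ m : ℤ, theta p (x * q ^ m) ≠ 0)
    (δ s t : ℤ) :
    thetaFactorial q p (x * q ^ δ * q ^ (1 - s)) t / thetaFactorial q p (x * q ^ δ * q) t =
      thetaFactorial q p x (δ + 1 - s + t) * thetaFactorial q p x (δ + 1) /
        (thetaFactorial q p x (δ + 1 - s) * thetaFactorial q p x (δ + 1 + t)) := by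
  have h1 := thetaFactorial_ne_zero h (δ + 1 - s)
  have h2 := thetaFactorial_ne_zero h (δ + 1)
  have h3 := thetaFactorial_ne_zero h (δ + 1 + t)
  rw [mul_assoc, ← zpow_add₀ hq, mul_assoc x, ← zpow_add_one₀ hq, thetaFactorial_mul_zpow hq h,
    thetaFactorial_mul_zpow hq h, ← add_sub_assoc]
  field_simp

/-- The pairs `i < j` that contain `m` correspond to the indices different from `m`. -/
lemma prod_prod_gt_ite (m : Fin r) (τ : Fin r → ℂ) :
    ∏ i, ∏ j ∈ Finset.univ.filter (fun j => i < j),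
      (if i = m then τ j else if j = m then τ i else 1) = ∏ j, if j = m then 1 else τ j := by
  have e : ∀ i, i ≠ m → ∏ j ∈ Finset.univ.filter (fun j => i < j),
      (if i = m then τ j else if j = m then τ i else 1) = if i < m then τ i else 1 := by
    intro i hi
    simp only [if_neg hi, Finset.prod_ite_eq', Finset.mem_filter, Finset.mem_univ, true_and]
  rw [← Finset.mul_prod_erase Finset.univ _ (Finset.mem_univ m),
    ← Finset.mul_prod_erase Finset.univ (fun j => ite (j = m) _ _) (Finset.mem_univ m),
    Finset.prod_congr rfl fun i hi => e i (Finset.ne_of_mem_erase hi), if_pos rfl, one_mul]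
  have e2 : ∏ j ∈ Finset.univ.filter (fun j => m < j),
      (if m = m then τ j else if j = m then τ m else 1) =
      ∏ j ∈ Finset.univ.erase m, if m < j then τ j else 1 := by
    rw [← Finset.prod_filter]
    refine Finset.prod_congr ?_ fun j _ => if_pos rfl
    ext j
    simp only [Finset.mem_filter, Finset.mem_univ, true_and, Finset.mem_erase, and_true]
    exact ⟨fun h => ⟨h.ne', h⟩, fun h => h.2⟩
  rw [e2, ← Finset.prod_mul_distrib]
  refine Finset.prod_congr rfl fun j hj => ?_
  have hj := Finset.ne_of_mem_erase hj
  rcases lt_or_gt_of_ne hj with h | h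
  · simp [h, hj, h.not_gt]
  · simp [h, hj, h.not_gt]

lemma multNumer_single {q p : ℂ} {a : Fin r → ℂ} (h : Generic q p a)
    (hθq : theta p q ≠ 0) (m : Fin r) : multNumer q p a (Pi.single m 1) = theta p (a m * q) := by
  have f1 : ∀ x, thetaFactorial q p x 1 = theta p x := fun x => by
    change ∏ k ∈ Finset.range 1, _ = _
    simp
  have s1 : ∑ i, (Pi.single m 1 : Fin r → ℤ) i = 1 := by simp
  rw [multNumer, s1, Finset.prod_eq_single m, Finset.prod_eq_single m, Finset.prod_eq_one]
  · simp only [Pi.single_eq_same, f1]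
    rw [div_self hθq]
    simp
  · intro i _
    refine Finset.prod_eq_one fun j hj => ?_
    have hij := (Finset.mem_filter.mp hj).2
    rcases eq_or_ne j m with rfl | hjm
    · have := h.theta_div_ne_zero i j 1 hij
      rw [Pi.single_eq_same, Pi.single_eq_of_ne hij.ne, sub_zero, zpow_one, f1]
      rw [zpow_one, div_mul_eq_mul_div] at this
      exact div_self this
    · rw [Pi.single_eq_of_ne hjm, thetaFactorial_zero, thetaFactorial_zero, div_one]
  · intro i _ him
    rw [Pi.single_eq_of_ne him, thetaFactorial_zero]
  · simp
  · intro i _ him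
    rw [Pi.single_eq_of_ne him, thetaFactorial_zero]
  · simp

/-- How the factors of `multNumer` in the base `q` change when one unit is removed from `n m`. -/
lemma base_ratio {q p : ℂ} {N : ℕ} {n : Fin r → ℕ} (hn : ∑ i, n i = N + 1)
    (hgen : ∀ m : ℕ, 1 ≤ m → m ≤ N + 1 → theta p (q ^ m) ≠ 0) {m : Fin r} (hm : n m ≠ 0) :
    thetaFactorial q p q N / ∏ i, thetaFactorial q p q ((n i : ℤ) - (Pi.single m 1 : Fin r → ℤ) i) =
      thetaFactorial q p q ((N : ℤ) + 1) / (∏ i, thetaFactorial q p q (n i)) *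
        (theta p (q ^ n m) / theta p (q ^ (N + 1))) := by
  have hle : ∀ i, n i ≤ N + 1 := fun i =>
    hn ▸ Finset.single_le_sum (f := n) (fun _ _ => Nat.zero_le _) (Finset.mem_univ i)
  rw [← Finset.mul_prod_erase Finset.univ _ (Finset.mem_univ m),
    ← Finset.mul_prod_erase Finset.univ (fun i => thetaFactorial q p q (n i)) (Finset.mem_univ m)]
  have e : ∏ i ∈ Finset.univ.erase m,
      thetaFactorial q p q ((n i : ℤ) - (Pi.single m 1 : Fin r → ℤ) i) =
      ∏ i ∈ Finset.univ.erase m, thetaFactorial q p q (n i) := by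
    refine Finset.prod_congr rfl fun i hi => ?_
    rw [Pi.single_eq_of_ne (Finset.ne_of_mem_erase hi), sub_zero]
  obtain ⟨d, hd⟩ := Nat.exists_eq_succ_of_ne_zero hm
  have hdN := hle m
  rw [e, Pi.single_eq_same, hd]
  push_cast
  rw [add_sub_cancel_right, thetaFactorial_base_add_one, thetaFactorial_base_add_one]
  have h1 := hgen (N + 1) (by omega) le_rfl
  have h2 := hgen (d + 1) (by omega) (by omega)
  have h3 : thetaFactorial q p q d ≠ 0 := thetaFactorial_base_ne_zero (N := N + 1) (by omega) hgen
  have h4 : ∏ i ∈ Finset.univ.erase m, thetaFactorial q p q (n i) ≠ 0 :=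
    Finset.prod_ne_zero_iff.mpr fun i _ => thetaFactorial_base_ne_zero (hle i) hgen
  field_simp

/-- How the factors of `multNumer` in the single variables change when one unit is removed from
`n m`. -/
lemma variable_ratio {q p : ℂ} (hq : q ≠ 0) {a : Fin r → ℂ} (h : Generic q p a) (N : ℤ)
    (n : Fin r → ℤ) (m : Fin r) :
    ∏ i, thetaFactorial q p (shiftBase q a 2 (Pi.single m 1) i *
        q ^ (1 + N - (n - Pi.single m 1 : Fin r → ℤ) i)) ((n - Pi.single m 1 : Fin r → ℤ) i) =
      (∏ i, thetaFactorial q p (a i * q ^ (1 + (N + 1) - n i)) (n i)) *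
        ((∏ i, theta p (a i * q ^ (N + 2)) / theta p (a i * q ^ (N + 2 - n i))) /
          theta p (a m * q ^ (N + 2))) := by
  have ht : theta p (a m * q ^ (N + 2)) = ∏ i, if i = m then theta p (a i * q ^ (N + 2)) else 1 := by
    simp
  rw [ht, ← Finset.prod_div_distrib, ← Finset.prod_mul_distrib]
  refine Finset.prod_congr rfl fun i _ => ?_
  have hi := h.theta_ne_zero i
  have hs := thetaFactorial_add_one hi
  have h0 := thetaFactorial_ne_zero hi
  have h1 := hi (N + 2)
  have h2 := hi (N + 2 - n i)
  rw [shiftBase, mul_assoc, ← zpow_add₀ hq, thetaFactorial_mul_zpow hq hi,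
    thetaFactorial_mul_zpow hq hi, Pi.sub_apply]
  rcases eq_or_ne i m with rfl | him
  · rw [Pi.single_eq_same, if_pos rfl,
      show 2 - 1 + (1 + N - (n i - 1)) + (n i - 1) = N + 2 by ring,
      show 2 - 1 + (1 + N - (n i - 1)) = N + 2 - n i + 1 by ring,
      show 1 + (N + 1) - n i + n i = N + 2 by ring, show 1 + (N + 1) - n i = N + 2 - n i by ring, hs]
    have := h0 (N + 2 - n i)
    field_simp
  · rw [Pi.single_eq_of_ne him, if_neg him,
      show 2 - 0 + (1 + N - (n i - 0)) + (n i - 0) = N + 2 + 1 by ring,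
      show 2 - 0 + (1 + N - (n i - 0)) = N + 2 - n i + 1 by ring,
      show 1 + (N + 1) - n i + n i = N + 2 by ring, show 1 + (N + 1) - n i = N + 2 - n i by ring,
      hs, hs]
    have := h0 (N + 2 - n i)
    field_simp

/-- How the factors of `multNumer` in the quotients `a_i / a_j` change when one unit is removed
from `n m`, together with the pair weight of that step. For `j = m` the inversion `θ(1 / x)` absorbs
the power of `q`, so that the result is the same for both positions of `m`. -/
lemma pair_ratio {q p : ℂ} (hq : q ≠ 0) (hp : ‖p‖ < 1) {a : Fin r → ℂ} (h : Generic q p a)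
    (n : Fin r → ℤ) (m : Fin r) {i j : Fin r} (hij : i < j) :
    thetaFactorial q p (shiftBase q a 2 (Pi.single m 1) i * q ^ (1 - (n - Pi.single m 1 : Fin r → ℤ) i) /
        shiftBase q a 2 (Pi.single m 1) j) ((n - Pi.single m 1 : Fin r → ℤ) j) /
      thetaFactorial q p (shiftBase q a 2 (Pi.single m 1) i * q / shiftBase q a 2 (Pi.single m 1) j)
        ((n - Pi.single m 1 : Fin r → ℤ) j) * pairWeight q p a n (Pi.single m 1) i j =
    thetaFactorial q p (a i * q ^ (1 - n i) / a j) (n j) / thetaFactorial q p (a i * q / a j) (n j) *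
      (if i = m then theta p (a m / a j * q ^ n j) / theta p (a m / a j) else
        if j = m then theta p (a m / a i * q ^ n i) / theta p (a m / a i) else 1) := by
  have hx := fun c => h.theta_div_ne_zero i j c hij
  have hs := thetaFactorial_add_one hx
  have h0 := thetaFactorial_ne_zero hx
  have e1 := multNumer_pair_eq hq hx ((Pi.single m 1 : Fin r → ℤ) j - (Pi.single m 1 : Fin r → ℤ) i)
    ((n - Pi.single m 1 : Fin r → ℤ) i) ((n - Pi.single m 1 : Fin r → ℤ) j)
  have e0 := multNumer_pair_eq hq hx 0 (n i) (n j)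
  rw [← shiftBase_div hq a 2, div_mul_eq_mul_div, div_mul_eq_mul_div] at e1
  rw [zpow_zero, mul_one, div_mul_eq_mul_div, div_mul_eq_mul_div] at e0
  rw [e1, e0, pairWeight]
  simp only [pairFactorial, Pi.sub_apply]
  have hx0 : a i / a j ≠ 0 := div_ne_zero (h.ne_zero i) (h.ne_zero j)
  have hT1 : theta p (a i / a j) ≠ 0 := by simpa using hx 0
  have z0 := hs 0
  rw [zpow_zero, mul_one, thetaFactorial_zero, one_mul, zero_add] at z0
  rcases eq_or_ne i m with rfl | him
  · rw [Pi.single_eq_same, Pi.single_eq_of_ne hij.ne', if_pos rfl]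
    have z1 := hs (n j)
    have z2 := hs (-n i)
    have h1 := h0 (n j)
    have h2 := h0 (-n i)
    have h3 := h0 (-n i + n j + 1)
    have h4 := hx (-n i)
    have h5 := hx (n j)
    have h6 := h0 (-1)
    simp only [zero_mul, zpow_zero, one_mul, zero_sub, sub_zero, neg_add_cancel, zero_add,
      thetaFactorial_zero, mul_one]
    rw [show -(n i - 1) + n j = -n i + n j + 1 by ring,
      show -(n i - 1) = -n i + 1 by ring, show 1 - n i + n j = -n i + n j + 1 by ring,
      show 1 - n i = -n i + 1 by ring, show 1 + n j = n j + 1 by ring, z0, z1, z2]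
    generalize theta p (a i / a j) = T1 at *
    generalize theta p (a i / a j * q ^ n j) = T2 at *
    generalize theta p (a i / a j * q ^ (-n i)) = T3 at *
    field_simp
  · rcases eq_or_ne j m with rfl | hjm
    · rw [Pi.single_eq_same, Pi.single_eq_of_ne hij.ne, if_neg him, if_pos rfl]
      have z2 := hs (-n i)
      have z3 := hs 1
      have h1 := h0 (1 + n j)
      have h2 := h0 (-n i)
      have h3 := h0 (1 - n i + n j)
      have h4 := hx (-n i)
      have h6 := h0 2
      have h7 := h0 (2 - n i)
      have h8 := hx 1
      have hqn := zpow_ne_zero (n i) hq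
      have t := theta_inv_div_theta_inv hp (y := a j / a i * q ^ n i) (z := a j / a i)
        (mul_ne_zero (div_ne_zero (h.ne_zero j) (h.ne_zero i)) hqn)
        (div_ne_zero (h.ne_zero j) (h.ne_zero i))
      rw [mul_inv, inv_div, ← zpow_neg, ← div_div, div_self
        (div_ne_zero (h.ne_zero j) (h.ne_zero i)), one_div] at t
      simp only [one_mul, sub_zero, neg_zero, zero_add, thetaFactorial_zero]
      rw [show (1 : ℤ) + 1 - n i + (n j - 1) = 1 - n i + n j by ring,
        show (1 : ℤ) + 1 + (n j - 1) = 1 + n j by ring, show (1 : ℤ) + 1 - n i = 2 - n i by ring,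
        show 1 - n i + 1 = 2 - n i by ring, show (1 : ℤ) + 1 = 2 by norm_num,
        show 1 - n i = -n i + 1 by ring, z0, z2]
      have t' : theta p (a j / a i * q ^ n i) / theta p (a j / a i) =
          q ^ n i * (theta p (a i / a j * q ^ (-n i)) / theta p (a i / a j)) := by
        rw [t]
        field_simp
      rw [t']
      rw [show 1 - n i + n j = -n i + 1 + n j by ring] at h3
      generalize theta p (a i / a j) = T1 at *
      generalize theta p (a i / a j * q ^ (-n i)) = T3 at *
      field_simp
    · rw [Pi.single_eq_of_ne (Ne.symm him).symm, Pi.single_eq_of_ne hjm, if_neg him, if_neg hjm]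
      have h1 := h0 (-n i)
      have h2 := h0 (-n i + 1)
      simp only [zero_mul, zpow_zero, one_mul, zero_sub, sub_zero, neg_zero, zero_add, mul_one,
        thetaFactorial_zero]
      rw [mul_right_eq_self₀]
      left
      have := h0 1
      field_simp

/-- One summand of the recurrence as a multiple of `multNumer q p a n`. -/
lemma multNumer_mul_crossWeight_single {q p : ℂ} (hq : q ≠ 0) (hp : ‖p‖ < 1) {a : Fin r → ℂ}
    (h : Generic q p a) {N : ℕ} {n : Fin r → ℕ} (hn : ∑ i, n i = N + 1)
    (hgen : ∀ m : ℕ, 1 ≤ m → m ≤ N + 1 → theta p (q ^ m) ≠ 0) (m : Fin r) :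
    multNumer q p (shiftBase q a 2 (Pi.single m 1)) ((fun i => (n i : ℤ)) - Pi.single m 1) *
        crossWeight q p a (fun i => (n i : ℤ)) (Pi.single m 1) =
      multNumer q p a (fun i => (n i : ℤ)) * (theta p (q ^ n m) / theta p (q ^ (N + 1))) *
        ((∏ i, theta p (a i * q ^ (N + 2 : ℤ)) / theta p (a i * q ^ (N + 2 - n i : ℤ))) /
          theta p (a m * q ^ (N + 2 : ℤ))) *
        ∏ j, if j = m then 1 else theta p (a m / a j * q ^ n j) / theta p (a m / a j) := by
  rcases eq_or_ne (n m) 0 with hm | hm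
  · rw [multNumer_eq_zero hq hp (i := m) _ (by simp [hm]), hm, pow_zero, theta_one hp]
    ring
  have hnz : ∑ i, (n i : ℤ) = N + 1 := by exact_mod_cast congrArg (Nat.cast : ℕ → ℤ) hn
  have hs : ∑ i, ((fun i => (n i : ℤ)) - Pi.single m 1 : Fin r → ℤ) i = N := by
    rw [sum_sub_single, hnz, add_sub_cancel_right]
  have hb := base_ratio hn hgen hm
  have hv := variable_ratio hq h N (fun i => (n i : ℤ)) m
  have hpr := fun i => Finset.prod_congr (rfl : Finset.univ.filter (fun j => i < j) = _)
    fun j hj => pair_ratio hq hp h (fun i => (n i : ℤ)) m (Finset.mem_filter.mp hj).2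
  have hP := Finset.prod_congr (rfl : (Finset.univ : Finset (Fin r)) = _) fun i _ => hpr i
  simp only [Finset.prod_mul_distrib] at hP
  rw [prod_prod_gt_ite m fun j => theta p (a m / a j * q ^ (n j : ℤ)) / theta p (a m / a j)] at hP
  simp only [zpow_natCast] at hP
  rw [multNumer, multNumer, hs, hnz, hv, crossWeight,
    mul_assoc _ _ (∏ i, ∏ j ∈ _, pairWeight _ _ _ _ _ i j), hP]
  simp only [Pi.sub_apply]
  rw [hb]
  ring

/-- The case `M = 1` of the convolution. -/
theorem multNumer_recurrence {q p : ℂ} (hq : q ≠ 0) (hp : ‖p‖ < 1) {a : Fin r → ℂ}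
    (h : Generic q p a) {N : ℕ} {n : Fin r → ℕ} (hn : ∑ i, n i = N + 1)
    (hgen : ∀ m : ℕ, 1 ≤ m → m ≤ N + 1 → theta p (q ^ m) ≠ 0) :
    multNumer q p a (fun i => (n i : ℤ)) = ∑ m, multNumer q p a (Pi.single m 1) *
      (multNumer q p (shiftBase q a 2 (Pi.single m 1)) ((fun i => (n i : ℤ)) - Pi.single m 1) *
        crossWeight q p a (fun i => (n i : ℤ)) (Pi.single m 1)) := by
  have hθq : theta p q ≠ 0 := by simpa using hgen 1 le_rfl (by omega)
  have hθN := hgen (N + 1) (by omega) le_rfl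
  have hnz : ∑ i, (n i : ℤ) = N + 1 := by exact_mod_cast congrArg (Nat.cast : ℕ → ℤ) hn
  have key := sum_theta_recurrence hq hp h N (fun i => (n i : ℤ)) hnz
  simp only [zpow_natCast] at key
  set R := ∏ i, theta p (a i * q ^ (N + 2 : ℤ)) / theta p (a i * q ^ (N + 2 - n i : ℤ)) with hR
  have hR' : ∏ i, theta p (a i * q ^ (N + 2 - n i : ℤ)) / theta p (a i * q ^ (N + 2 : ℤ)) = R⁻¹ := by
    rw [hR, ← Finset.prod_inv_distrib]
    simp only [inv_div]
  have hR0 : R ≠ 0 := Finset.prod_ne_zero_iff.mpr fun i _ =>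
    div_ne_zero (h.theta_ne_zero i _) (h.theta_ne_zero i _)
  rw [hR'] at key
  have e : ∀ m, multNumer q p a (Pi.single m 1) *
      (multNumer q p (shiftBase q a 2 (Pi.single m 1)) ((fun i => (n i : ℤ)) - Pi.single m 1) *
        crossWeight q p a (fun i => (n i : ℤ)) (Pi.single m 1)) =
      multNumer q p a (fun i => (n i : ℤ)) * R / theta p (q ^ (N + 1)) *
        (theta p (a m * q) * theta p (q ^ n m) / theta p (a m * q ^ (N + 2 : ℤ)) *
        ∏ j, (if j = m then 1 else theta p (a m / a j * q ^ n j) / theta p (a m / a j))) := by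
    intro m
    rw [multNumer_mul_crossWeight_single hq hp h hn hgen, multNumer_single h hθq]
    ring
  rw [Finset.sum_congr rfl fun m _ => e m, ← Finset.mul_sum, key]
  field_simp

/-! ### The convolution for a general number of steps -/

lemma single_le_of_ne_zero {k : Fin r → ℕ} {m : Fin r} (h : k m ≠ 0) : Pi.single m 1 ≤ k := by
  intro i
  rcases eq_or_ne i m with rfl | him
  · rw [Pi.single_eq_same]
    exact Nat.one_le_iff_ne_zero.mpr h
  · rw [Pi.single_eq_of_ne him]
    exact Nat.zero_le _

/-- Sums over compositions of `M + 1` with a marked nonzero part, as sums over compositions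
of `M`. -/
lemma sum_piAntidiag_succ (M : ℕ) (m : Fin r) (G : (Fin r → ℤ) → ℂ)
    (hG : ∀ k : Fin r → ℤ, k m = 0 → G k = 0) :
    ∑ k ∈ Finset.piAntidiag (Finset.univ : Finset (Fin r)) (M + 1), G (fun i => (k i : ℤ)) =
      ∑ k ∈ Finset.piAntidiag (Finset.univ : Finset (Fin r)) M,
        G ((fun i => (k i : ℤ)) + Pi.single m 1) := by
  have hc : ∀ k : Fin r → ℕ, (fun i => ((k + Pi.single m 1 : Fin r → ℕ) i : ℤ)) =
      (fun i => (k i : ℤ)) + Pi.single m 1 := by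
    intro k
    funext i
    rcases eq_or_ne i m with rfl | him <;> simp_all
  rw [← Finset.sum_filter_of_ne (p := fun k => k m ≠ 0)
    fun k _ hk hkm => hk (hG _ (by simp [hkm]))]
  symm
  refine Finset.sum_nbij' (fun k => k + Pi.single m 1) (fun k => k - Pi.single m 1) ?_ ?_ ?_ ?_ ?_
  · intro k hk
    simp only [Finset.mem_piAntidiag, Finset.mem_filter] at hk ⊢
    exact ⟨⟨by simp [Finset.sum_add_distrib, hk.1], by simp⟩, by simp⟩
  · intro k hk
    simp only [Finset.mem_piAntidiag, Finset.mem_filter] at hk ⊢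
    have h1 : k - Pi.single m 1 + Pi.single m 1 = k :=
      tsub_add_cancel_of_le (single_le_of_ne_zero hk.2)
    have h2 := congrArg (fun f : Fin r → ℕ => ∑ i, f i) h1
    simp only [Pi.add_apply, Finset.sum_add_distrib, hk.1.1] at h2
    simp at h2
    exact ⟨by simpa using h2, by simp⟩
  · intro k _
    exact add_tsub_cancel_right k _
  · intro k hk
    have hk := (Finset.mem_filter.mp hk).2
    exact tsub_add_cancel_of_le (single_le_of_ne_zero hk)
  · intro k _
    rw [hc]

/-- The convolution for `multNumer`. The induction takes one step off the left factor; the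
cocycle relation of the cross weights makes the inner sum collapse by the recurrence. -/
theorem multNumer_convolution {q p : ℂ} (hq : q ≠ 0) (hp : ‖p‖ < 1) (M : ℕ) {a : Fin r → ℂ}
    (h : Generic q p a) {n : Fin r → ℕ} (hM : M ≤ ∑ i, n i)
    (hgen : ∀ m : ℕ, 1 ≤ m → m ≤ ∑ i, n i → theta p (q ^ m) ≠ 0) :
    multNumer q p a (fun i => (n i : ℤ)) =
      ∑ k ∈ Finset.piAntidiag (Finset.univ : Finset (Fin r)) M,
        multNumer q p a (fun i => (k i : ℤ)) *
          (multNumer q p (shiftBase q a (2 * M) (fun i => (k i : ℤ)))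
              ((fun i => (n i : ℤ)) - fun i => (k i : ℤ)) *
            crossWeight q p a (fun i => (n i : ℤ)) (fun i => (k i : ℤ))) := by
  induction M generalizing a n with
  | zero =>
    have e : shiftBase q a (2 * (0 : ℕ)) (0 : Fin r → ℤ) = a := by
      funext i
      simp [shiftBase]
    have e0 : (fun i => ((0 : Fin r → ℕ) i : ℤ)) = 0 := by
      funext i
      simp
    rw [Finset.piAntidiag_zero, Finset.sum_singleton, e0, e, multNumer_zero, crossWeight_zero h,
      sub_zero, one_mul, mul_one]
  | succ M ih =>
    obtain ⟨N, hN⟩ := Nat.exists_eq_succ_of_ne_zero (by omega : ∑ i, n i ≠ 0)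
    have hN : ∑ i, n i = N + 1 := hN
    rw [hN] at hgen hM
    set ν : Fin r → ℤ := fun i => (n i : ℤ) with hν
    set G : Fin r → (Fin r → ℤ) → ℂ := fun m k =>
      multNumer q p a (Pi.single m 1) *
          (multNumer q p (shiftBase q a 2 (Pi.single m 1)) (k - Pi.single m 1) *
            crossWeight q p a k (Pi.single m 1)) *
        (multNumer q p (shiftBase q a (2 * (M + 1 : ℕ)) k) (ν - k) * crossWeight q p a ν k) with hG
    have hG0 : ∀ m k, k m = 0 → G m k = 0 := by
      intro m k hk
      simp only [hG]
      rw [multNumer_eq_zero hq hp (k := k - Pi.single m 1) (i := m) _ (by simp [hk])]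
      simp
    have step : ∀ m, multNumer q p a (Pi.single m 1) *
        (multNumer q p (shiftBase q a 2 (Pi.single m 1)) (ν - Pi.single m 1) *
          crossWeight q p a ν (Pi.single m 1)) =
        ∑ k ∈ Finset.piAntidiag (Finset.univ : Finset (Fin r)) M,
          G m ((fun i => (k i : ℤ)) + Pi.single m 1) := by
      intro m
      rcases eq_or_ne (n m) 0 with hm | hm
      · rw [multNumer_eq_zero hq hp (i := m) (shiftBase q a 2 (Pi.single m 1)) (by simp [hν, hm]),
          zero_mul, mul_zero]
        symm
        refine Finset.sum_eq_zero fun k _ => ?_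
        simp only [hG]
        rw [multNumer_eq_zero hq hp (i := m) (shiftBase q a (2 * (M + 1 : ℕ)) _)]
        · simp
        · simp only [Pi.sub_apply, Pi.add_apply, Pi.single_eq_same, hν, hm]
          push_cast
          omega
      · set n' : Fin r → ℕ := n - Pi.single m 1 with hn'
        have hadd : n' + Pi.single m 1 = n := tsub_add_cancel_of_le (single_le_of_ne_zero hm)
        have hcast : (fun i => (n' i : ℤ)) = ν - Pi.single m 1 := by
          funext i
          have := congrFun hadd i
          simp only [Pi.add_apply] at this
          simp only [hν, Pi.sub_apply]
          rcases eq_or_ne i m with rfl | him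
          · rw [Pi.single_eq_same] at this ⊢; omega
          · rw [Pi.single_eq_of_ne him] at this ⊢; omega
        have hsum : ∑ i, n' i = N := by
          have h2 := congrArg (fun f : Fin r → ℕ => ∑ i, f i) hadd
          simp only [Pi.add_apply, Finset.sum_add_distrib, hN] at h2
          simpa using h2
        have := ih (h.shiftBase hq 2 (Pi.single m 1)) (n := n') (by omega)
          (fun j h1 h2 => hgen j h1 (by omega))
        rw [hcast] at this
        rw [this, Finset.sum_mul, Finset.mul_sum]
        refine Finset.sum_congr rfl fun k _ => ?_
        set κ : Fin r → ℤ := fun i => (k i : ℤ)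
        have hk : κ = κ + Pi.single m 1 - Pi.single m 1 := (add_sub_cancel_right _ _).symm
        have e1 := crossWeight_cocycle hq h 2 ν (κ + Pi.single m 1) (Pi.single m 1)
        have e2 := shiftBase_shiftBase hq a 2 (2 * M) (Pi.single m 1) (κ + Pi.single m 1)
        rw [← hk] at e1 e2
        simp only [hG]
        rw [← hk, e2, sub_sub, add_comm (Pi.single m 1) κ,
          show (2 + 2 * M : ℤ) = 2 * (M + 1 : ℕ) by push_cast; ring]
        linear_combination (multNumer q p a (Pi.single m 1) *
          multNumer q p (shiftBase q a 2 (Pi.single m 1)) κ *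
          multNumer q p (shiftBase q a (2 * (M + 1 : ℕ)) (κ + Pi.single m 1))
            (ν - (κ + Pi.single m 1))) * e1
    rw [multNumer_recurrence hq hp h hN hgen, Finset.sum_congr rfl fun m _ => step m,
      Finset.sum_congr rfl fun m _ => (sum_piAntidiag_succ M m (G m) (hG0 m)).symm,
      Finset.sum_comm]
    refine Finset.sum_congr rfl fun k hk => ?_
    have hk := (Finset.mem_piAntidiag.mp hk).1
    simp only [hG]
    rw [← Finset.sum_mul, ← multNumer_recurrence hq hp h hk fun j h1 h2 => hgen j h1 (h2.trans hM)]

end EllMult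

theorem theorem4p1 (r : ℕ) (q p : ℂ) (hq : q ≠ 0) (hp : ‖p‖ < 1)
    (a : Fin r → ℂ) (ha : ∀ i, a i ≠ 0)
    (M N : ℕ) (hMN : M ≤ N) (n : Fin r → ℕ) (hn : ∑ i, n i = N)
    -- genericity of the base and of the variables: no denominator vanishes
    (hgen_q : ∀ m : ℕ, 1 ≤ m → m ≤ N → EllMult.theta p (q ^ m) ≠ 0)
    (hgen_a : ∀ (i : Fin r) (m : ℤ), EllMult.theta p (a i * q ^ m) ≠ 0)
    (hgen_aa : ∀ (i j : Fin r) (m : ℤ), i < j → EllMult.theta p (a i * q ^ m / a j) ≠ 0) :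
    EllMult.ellMultinomial q p a (fun i => (n i : ℤ)) =
      ∑ k ∈ Finset.piAntidiag (Finset.univ : Finset (Fin r)) M,
        EllMult.ellMultinomial q p a (fun i => (k i : ℤ)) *
          EllMult.ellMultinomial q p
            (fun i => a i * q ^ (2 * (M : ℤ) - (k i : ℤ)))
            (fun i => (n i : ℤ) - (k i : ℤ)) *
          ∏ i, ∏ j ∈ Finset.univ.filter (fun j => i < j),
            EllMult.bigQWeight q p (a i) (a j)
              ((n i : ℤ) - (k i : ℤ))
              (EllMult.sumBefore (fun ν => (n ν : ℤ)) i +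
                EllMult.sumBefore (fun ν => (k ν : ℤ)) j -
                EllMult.sumUpTo (fun ν => (k ν : ℤ)) i)
              (k i : ℤ) (k j : ℤ) := by
  have h : EllMult.Generic q p a := ⟨ha, hgen_a, fun i j m hij => by
    rw [div_mul_eq_mul_div]
    exact hgen_aa i j m hij⟩
  subst hn
  rw [EllMult.ellMultinomial_eq_div, EllMult.multNumer_convolution hq hp M h hMN hgen_q,
    Finset.sum_div]
  refine Finset.sum_congr rfl fun k hk => ?_
  have hkM : ∑ i, (k i : ℤ) = M := by
    exact_mod_cast congrArg (Nat.cast : ℕ → ℤ) (Finset.mem_piAntidiag.mp hk).1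
  have e := EllMult.prod_bigQWeight_eq hq h (fun i => (n i : ℤ)) (fun i => (k i : ℤ))
  rw [hkM] at e
  rw [e, EllMult.ellMultinomial_eq_div, EllMult.ellMultinomial_eq_div]
  change _ = _ * (EllMult.multNumer q p (EllMult.shiftBase q a (2 * M) fun i => (k i : ℤ))
      ((fun i => (n i : ℤ)) - fun i => (k i : ℤ)) /
    EllMult.multDenom q p (EllMult.shiftBase q a (2 * M) fun i => (k i : ℤ))
      ((fun i => (n i : ℤ)) - fun i => (k i : ℤ))) * _
  have d1 := EllMult.multDenom_ne_zero hq h fun i => (k i : ℤ)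
  have d2 := EllMult.multDenom_ne_zero hq h fun i => (n i : ℤ)
  have d3 := EllMult.multDenom_ne_zero hq (h.shiftBase hq (2 * M) fun i => (k i : ℤ))
    ((fun i => (n i : ℤ)) - fun i => (k i : ℤ))
  field_simp
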